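/- **Setting.** Let $d\in\{2,3\}$, $\eta>0$, $\sigma>0$. Let $\Omega\subset\mathbb R^d$ be a bounded open set and $\mathcal T_h$ a conforming triangulation of $\Omega$ into $d$-simplices (finite; $\Omega$ is the interior of the union of the closed simplices), shape-regular in the sense that each $T\in\mathcal T_h$ contains a ball of diameter $\rho_T$ with $h_T:=\operatorname{diam}T\le\sigma\rho_T$. Let $\mathcal E_h$ be the set of its interior and boundary sides $e$, $h_e:=\operatorname{diam}e$. On an interior side $e=\partial T_1\cap\partial T_2$ with outward unit normals $\boldsymbol n_1,\boldsymbol n_2$ put $\{\boldsymbol\tau\}=\frac12(\boldsymbol\tau|_{T_1}\boldsymbol n_1-\boldsymbol\tau|_{T_2}\boldsymbol n_2)$ and $[\boldsymbol u_t]=\boldsymbol u_t|_{T_1}-\boldsymbol u_t|_{T_2}$; on a boundary side $\{\boldsymbol\tau\}=\boldsymbol\tau\boldsymbol n$ and $[\boldsymbol u_t]=\boldsymbol u_t$, where $\boldsymbol u_t$ is the tangential component of $\boldsymbol u$. $(\cdot,\cdot)$ and $\|\cdot\|$ are the inner product and norm of $L^2(\Omega)$ (of scalar or vector functions), and $\boldsymbol\epsilon(\boldsymbol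 u)=\frac12(\nabla\boldsymbol u+(\nabla\boldsymbol u)^T)$. **Spaces.** For $l\ge1$ let $\tilde{\boldsymbol U}(T)=\boldsymbol U_i(T)$ be, for all $T$, $BDM_l(T)$, or, for all $T$, $BDFM_l(T)=\{\boldsymbol v\in P_l(T)^d:\boldsymbol v\cdot\boldsymbol n|_e\in P_{l-1}(e)\text{ for each side }e\text{ of }T\}$; let $\tilde{\boldsymbol V}(T)=\boldsymbol V_i(T)=RT_{l-1}(T)$, $Q_i(T)=P_{l-1}(T)$. For $n\ge1$ networks, $\tilde{\boldsymbol U}_h$, $\boldsymbol U_{i,h}$, $\tilde{\boldsymbol V}_h$, $\boldsymbol V_{i,h}$ consist of the fields in $H(\mathrm{div};\Omega)$ that belong on each $T\in\mathcal T_h$ to the respective local space and have zero normal component on $\partial\Omega$; $P_{i,h}$ consists of the $p\in L^2(\Omega)$ with $p|_T\in Q_i(T)$ for all $T$ and $\int_\Omega p=0$; $\boldsymbol U_h=\prod_{i=1}^n\boldsymbol U_{i,h}$, $\boldsymbol V_h=\prod_{i=1}^n\boldsymbol V_{i,h}$, $\boldsymbol P_h=\prod_{i=1}^nP_{i,h}$.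 **Parameters.** $\tau,\mu,\rho_s>0$, $\lambda\ge0$; for $1\le i\le n$: $\rho_i>0$, $K_i>0$, $c_{p_i}\ge0$, $\varphi_i\in(0,1)$ with $\varphi:=\sum_i\varphi_i\in(0,1)$, $\rho_{m_i}\ge\rho_i/\varphi_i$, $\tilde\alpha_i\in[\varphi_i,1]$; $\tilde\beta_{ij}=\tilde\beta_{ji}\ge0$ for $i\ne j$. Put $\alpha_i=\tilde\alpha_i-\varphi_i$, $\boldsymbol\alpha=\mathrm{diag}(\alpha_1,\dots,\alpha_n)$, $$\gamma_i=-(\rho_i-\varphi_i\rho_{m_i})+\tfrac\tau2\varphi_iK_i^{-1},\quad \gamma_u=(1-\varphi)\rho_s+1+\sum_{i=1}^n\varphi_i\gamma_i,\quad \gamma_{v,i}=\tfrac{\rho_i+\gamma_i}{\varphi_i}+1,\quad \gamma=\max\{\tfrac{\tau^2\mu}2,\tfrac{\tau^2\lambda}4,\gamma_u\},$$ $\bar{\mathcal A}_{12}=\bar{\mathcal A}_{21}^T=(-\gamma_1,\dots,-\gamma_n)$, $\bar{\mathcal A}_{22}=\mathrm{diag}(\gamma_{v,1},\dots,\gamma_{v,n})$,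 $$\Lambda_{uv}=\begin{bmatrix}\gamma_u&\bar{\mathcal A}_{12}&-\frac\tau2I&0\\ \bar{\mathcal A}_{21}&\bar{\mathcal A}_{22}&0&-\frac\tau2I\\ -\frac\tau2I&0&\frac{\tau^2}4I&0\\ 0&-\frac\tau2I&0&\frac{\tau^2}4I\end{bmatrix},\qquad \Lambda=\Lambda_1+\Lambda_2+\Lambda_3,\quad \Lambda_2=\tfrac{\tau^2}4\bar{\mathcal A}_{22}^{-1},\quad \Lambda_3=\tfrac{\tau^2}{4\gamma}(\alpha_i\alpha_j)_{i,j=1}^n,$$ and let $\Lambda_1$ have the entries $-\frac\tau2\tilde\beta_{ij}$ for $i\neq j$ and $\frac\tau2\sum_{j\ne i}\tilde\beta_{ij}+c_{p_i}$ on the diagonal. **Forms and norms.** Let $$a_h(\boldsymbol u,\boldsymbol w)=\sum_{T}\int_T\boldsymbol\epsilon(\boldsymbol u):\boldsymbol\epsilon(\boldsymbol w)\,dx-\sum_{e\in\mathcal E_h}\int_e\{\boldsymbol\epsilon(\boldsymbol u)\}\cdot[\boldsymbol w_t]\,ds-\sum_{e\in\mathcal E_h}\int_e\{\boldsymbol\epsilon(\boldsymbol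 w)\}\cdot[\boldsymbol u_t]\,ds+\sum_{e\in\mathcal E_h}\int_e\eta h_e^{-1}[\boldsymbol u_t]\cdot[\boldsymbol w_t]\,ds,$$ $$\|\boldsymbol u\|_{DG}^2=\sum_T\|\nabla\boldsymbol u\|_{0,T}^2+\sum_{e\in\mathcal E_h}h_e^{-1}\|[\boldsymbol u_t]\|_{0,e}^2+\sum_Th_T^2|\boldsymbol u|_{2,T}^2 .$$ For $x=(\boldsymbol u;\boldsymbol v;\dot{\boldsymbol u};\dot{\boldsymbol v};\boldsymbol p)$ and $y=(\boldsymbol w;\boldsymbol z;\tilde{\boldsymbol w};\tilde{\boldsymbol z};\boldsymbol q)$ write $D_x=(\mathrm{div}\,\boldsymbol v_i+\alpha_i\,\mathrm{div}\,\boldsymbol u)_{i=1}^n$, $D_y=(\mathrm{div}\,\boldsymbol z_i+\alpha_i\,\mathrm{div}\,\boldsymbol w)_{i=1}^n$ and $$\mathcal A_h(x,y)=\tfrac{\mu\tau^2}2a_h(\boldsymbol u,\boldsymbol w)+\tfrac{\tau^2\lambda}4(\mathrm{div}\,\boldsymbol u,\mathrm{div}\,\boldsymbol w)+\big(\Lambda_{uv}(\boldsymbol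 u,\boldsymbol v,\dot{\boldsymbol u},\dot{\boldsymbol v})^T,(\boldsymbol w,\boldsymbol z,\tilde{\boldsymbol w},\tilde{\boldsymbol z})^T\big)-\tfrac{\tau^2}4(\boldsymbol p,D_y)-\tfrac{\tau^2}4(D_x,\boldsymbol q)-\tfrac{\tau^2}4(\Lambda_1\boldsymbol p,\boldsymbol q),$$ $$\|(\boldsymbol u;\boldsymbol v;\dot{\boldsymbol u};\dot{\boldsymbol v})\|^2_{\tilde{\boldsymbol U}_h\times\boldsymbol U\times\tilde{\boldsymbol V}\times\boldsymbol V}=\tfrac{\mu\tau^2}2\|\boldsymbol u\|_{DG}^2+\tfrac{\tau^2\lambda}4\|\mathrm{div}\,\boldsymbol u\|^2+\|\Lambda_{uv}^{1/2}(\boldsymbol u,\boldsymbol v,\dot{\boldsymbol u},\dot{\boldsymbol v})^T\|^2+\tfrac{\tau^2}4\|\Lambda^{-1/2}D_x\|^2,\qquad \|\boldsymbol p\|_{\boldsymbol P}^2=\tfrac{\tau^2}4(\Lambda\boldsymbol p,\boldsymbol p).$$ **Theorem (boundedness, fully discrete).** There is a constant $C_d>0$ that depends only on $d$, $\eta$ and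 $\sigma$ (so it is independent of $\Omega$, of the triangulation and its mesh size $h$, of $l$ and the choice of family, of $n$ and of all the parameters) such that, for all $x=(\boldsymbol u_h;\boldsymbol v_h;\dot{\boldsymbol u}_h;\dot{\boldsymbol v}_h;\boldsymbol p_h)$ and $y=(\boldsymbol w_h;\boldsymbol z_h;\tilde{\boldsymbol w}_h;\tilde{\boldsymbol z}_h;\boldsymbol q_h)$ in $\tilde{\boldsymbol U}_h\times\boldsymbol U_h\times\tilde{\boldsymbol V}_h\times\boldsymbol V_h\times\boldsymbol P_h$, $$|\mathcal A_h(x,y)|\le C_d\big(\|(\boldsymbol u_h;\boldsymbol v_h;\dot{\boldsymbol u}_h;\dot{\boldsymbol v}_h)\|_{\tilde{\boldsymbol U}_h\times\boldsymbol U\times\tilde{\boldsymbol V}\times\boldsymbol V}+\|\boldsymbol p_h\|_{\boldsymbol P}\big)\big(\|(\boldsymbol w_h;\boldsymbol z_h;\tilde{\boldsymbol w}_h;\tilde{\boldsymbol z}_h)\|_{\tilde{\boldsymbol U}_h\times\boldsymbol U\times\tilde{\boldsymbol V}\times\boldsymbol V}+\|\boldsymbol q_h\|_{\boldsymbol P}\big).$$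 -/

import Mathlib

open MeasureTheory Set
open scoped Matrix ContDiff

noncomputable section

namespace MPET

/-- The space `ℝ^d` with its Euclidean norm. -/
abbrev E (d : ℕ) := EuclideanSpace ℝ (Fin d)

/-! ### Triangulations -/

/-- A conforming triangulation of `Ω ⊆ ℝ^d`: a finite simplicial complex, all of whose simplices are
faces of `d`-dimensional ones, and which covers `Ω`. The simplices are given by their vertex sets.
(By purity, `interior_space` also gives `closure Ω = complex.space`; it says that `Ω` is the bounded
polyhedral open set filled by the triangulation, so that `∂Ω` consists of the sides which belong to
one `d`-simplex only.) -/
structure Triangulation (d : ℕ) (Ω : Set (E d)) where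
  complex : Geometry.SimplicialComplex ℝ (E d)
  finite : complex.faces.Finite
  pure : ∀ s ∈ complex.faces, ∃ T ∈ complex.faces, s ⊆ T ∧ T.card = d + 1
  interior_space : interior complex.space = Ω

/-- The closed simplex with the given vertices. -/
def hull {d : ℕ} (s : Finset (E d)) : Set (E d) := convexHull ℝ (s : Set (E d))

/-- The open simplex with the given vertices (for a set of `d + 1` vertices). -/
def openCell {d : ℕ} (T : Finset (E d)) : Set (E d) := interior (hull T)

/-- The diameter of a simplex; this is `h_T` for elements and `h_e` for sides. -/
def size {d : ℕ} (s : Finset (E d)) : ℝ := Metric.diam (hull s)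

namespace Triangulation

variable {d : ℕ} {Ω : Set (E d)}

open Classical in
/-- The elements `T` of the triangulation (triangles if `d = 2`, tetrahedra if `d = 3`). -/
def cells (M : Triangulation d Ω) : Finset (Finset (E d)) :=
  M.finite.toFinset.filter fun s => s.card = d + 1

open Classical in
/-- The sides `e` of the triangulation (edges if `d = 2`, faces if `d = 3`). -/
def sides (M : Triangulation d Ω) : Finset (Finset (E d)) :=
  M.finite.toFinset.filter fun s => s.card = d

open Classical in
/-- An element `T₁` that contains the side `e`. -/
def cell₁ (M : Triangulation d Ω) (e : Finset (E d)) : Finset (E d) :=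
  if h : ∃ T ∈ M.cells, e ⊆ T then h.choose else ∅

/-- The side `e` belongs to an element other than `T₁`, that is, it is an interior side. -/
def IsInteriorSide (M : Triangulation d Ω) (e : Finset (E d)) : Prop :=
  ∃ T ∈ M.cells, e ⊆ T ∧ T ≠ M.cell₁ e

open Classical in
/-- The second element `T₂` that contains the interior side `e`. -/
def cell₂ (M : Triangulation d Ω) (e : Finset (E d)) : Finset (E d) :=
  if h : M.IsInteriorSide e then h.choose else ∅

/-- Shape regularity with constant `σ`: each element `T` contains a ball of diameter `2 r` with
`h_T ≤ σ * (2 r)`. -/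
def ShapeRegular (M : Triangulation d Ω) (σ : ℝ) : Prop :=
  ∀ T ∈ M.cells, ∃ (c : E d) (r : ℝ), 0 < r ∧ Metric.ball c r ⊆ hull T ∧ size T ≤ σ * (2 * r)

end Triangulation

/-- `ν` is the unit normal to the side `e` of the simplex `T` pointing out of `T`. -/
def IsOuterNormal {d : ℕ} (T e : Finset (E d)) (ν : E d) : Prop :=
  ‖ν‖ = 1 ∧ (∀ x ∈ e, ∀ y ∈ e, inner ℝ ν (y - x) = 0) ∧
    ∀ x ∈ e, ∀ y ∈ T, y ∉ e → inner ℝ ν (y - x) < 0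

open Classical in
/-- The outward unit normal of the simplex `T` on its side `e`. -/
def outerNormal {d : ℕ} (T e : Finset (E d)) : E d :=
  if h : ∃ ν, IsOuterNormal T e ν then h.choose else 0

/-- The integral over a side with respect to the `(d - 1)`-dimensional surface measure. -/
def sideIntegral {d : ℕ} (e : Finset (E d)) (f : E d → ℝ) : ℝ :=
  ∫ x in hull e, f x ∂(Measure.euclideanHausdorffMeasure (d - 1))

/-! ### Derivatives, traces, jumps and averages -/

/-- The Jacobian matrix `(∂_j u_i)_{ij}`. -/
def grad {d : ℕ} (u : E d → E d) (x : E d) : Matrix (Fin d) (Fin d) ℝ :=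
  Matrix.of fun i j => (fderiv ℝ u x (EuclideanSpace.single j 1)) i

/-- The symmetric gradient. -/
def sgrad {d : ℕ} (u : E d → E d) (x : E d) : Matrix (Fin d) (Fin d) ℝ :=
  (1 / 2 : ℝ) • (grad u x + (grad u x)ᵀ)

/-- The pointwise divergence. For a piecewise polynomial field in `H(div; Ω)` it agrees with the
weak divergence almost everywhere. -/
def div {d : ℕ} (u : E d → E d) (x : E d) : ℝ := (grad u x).trace

/-- The second partial derivative `∂_k ∂_j u_i`. -/
def second {d : ℕ} (u : E d → E d) (i j k : Fin d) (x : E d) : ℝ :=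
  fderiv ℝ (fun y => grad u y i j) x (EuclideanSpace.single k 1)

/-- Frobenius inner product `A : B`. -/
def frob {d : ℕ} (A B : Matrix (Fin d) (Fin d) ℝ) : ℝ := ∑ i, ∑ j, A i j * B i j

/-- The product of a matrix and a vector of `ℝ^d`. -/
def app {d : ℕ} (A : Matrix (Fin d) (Fin d) ℝ) (ν : E d) : E d := WithLp.toLp 2 (A *ᵥ ν.ofLp)

/-- The trace on `∂T` of (the restriction to the interior of `T` of) a function: its limit from
inside `T`. -/
def trace {d : ℕ} {F : Type*} [TopologicalSpace F] (T : Finset (E d)) (f : E d → F) : E d → F :=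
  extendFrom (openCell T) f

/-- The tangential component `a_t = a - (a ⬝ ν) ν`. -/
def tangential {d : ℕ} (ν a : E d) : E d := a - (inner ℝ a ν) • ν

section Side

variable {d : ℕ} {Ω : Set (E d)}

open Classical in
/-- The average `{A}` on the side `e` of a matrix field: `(A|_{T₁} n₁ - A|_{T₂} n₂) / 2` on an
interior side and `A n` on a boundary side. -/
def avg (M : Triangulation d Ω) (e : Finset (E d)) (A : E d → Matrix (Fin d) (Fin d) ℝ)
    (x : E d) : E d :=
  if M.IsInteriorSide e then
    (1 / 2 : ℝ) • (app (trace (M.cell₁ e) A x) (outerNormal (M.cell₁ e) e)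
      - app (trace (M.cell₂ e) A x) (outerNormal (M.cell₂ e) e))
  else app (trace (M.cell₁ e) A x) (outerNormal (M.cell₁ e) e)

open Classical in
/-- The jump `[u_t]` of the tangential component on the side `e`: the difference of the traces from
`T₁` and `T₂` on an interior side and the trace on a boundary side. -/
def jumpT (M : Triangulation d Ω) (e : Finset (E d)) (u : E d → E d) (x : E d) : E d :=
  if M.IsInteriorSide e then
    tangential (outerNormal (M.cell₁ e) e) (trace (M.cell₁ e) u x)
      - tangential (outerNormal (M.cell₂ e) e) (trace (M.cell₂ e) u x)
  else tangential (outerNormal (M.cell₁ e) e) (trace (M.cell₁ e) u x)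

/-- The discontinuous Galerkin bilinear form `a_h` with stabilization parameter `η`. -/
def aForm (M : Triangulation d Ω) (η : ℝ) (u w : E d → E d) : ℝ :=
  (∑ T ∈ M.cells, ∫ x in openCell T, frob (sgrad u x) (sgrad w x))
    - (∑ e ∈ M.sides, sideIntegral e (fun x => inner ℝ (avg M e (sgrad u) x) (jumpT M e w x)))
    - (∑ e ∈ M.sides, sideIntegral e (fun x => inner ℝ (avg M e (sgrad w) x) (jumpT M e u x)))
    + (∑ e ∈ M.sides,
        sideIntegral e (fun x => η * (size e)⁻¹ * inner ℝ (jumpT M e u x) (jumpT M e w x)))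

/-- The square of the DG norm. -/
def dgSq (M : Triangulation d Ω) (u : E d → E d) : ℝ :=
  (∑ T ∈ M.cells, ∫ x in openCell T, frob (grad u x) (grad u x))
    + (∑ e ∈ M.sides, (size e)⁻¹ * sideIntegral e (fun x => ‖jumpT M e u x‖ ^ 2))
    + (∑ T ∈ M.cells, size T ^ 2 *
        (∑ i, ∑ j, ∑ k ∈ Finset.Iic j, ∫ x in openCell T, second u i j k x ^ 2))

end Side

/-! ### Finite element spaces -/

/-- `f` is a polynomial function on `ℝ^d` of total degree at most `k`. -/
def IsPoly {d : ℕ} (k : ℕ) (f : E d → ℝ) : Prop :=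
  ∃ P : MvPolynomial (Fin d) ℝ, P.totalDegree ≤ k ∧ ∀ x, f x = MvPolynomial.eval (fun i => x i) P

/-- `BDM_l = (P_l)^d`. -/
def BDM (d l : ℕ) : Set (E d → E d) := {v | ∀ i, IsPoly l fun x => v x i}

/-- `RT_k = (P_k)^d + x P_k`. -/
def RT (d k : ℕ) : Set (E d → E d) :=
  {v | ∃ (a : E d → E d) (b : E d → ℝ), a ∈ BDM d k ∧ IsPoly k b ∧ ∀ x, v x = a x + b x • x}

/-- `BDFM_l(T)`: the fields in `(P_l)^d` whose normal component on each side of `T` is in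
`P_{l-1}`. -/
def BDFM (d l : ℕ) (T : Finset (E d)) : Set (E d → E d) :=
  {v | v ∈ BDM d l ∧ ∀ e ⊆ T, e.card = d →
    ∃ q, IsPoly (l - 1) q ∧ ∀ x ∈ hull e, inner ℝ (v x) (outerNormal T e) = q x}

/-- The two choices of the local spaces for the displacements. -/
inductive Family
  | bdm
  | bdfm

/-- The local displacement space on `T`. -/
def Family.space (fam : Family) (d l : ℕ) (T : Finset (E d)) : Set (E d → E d) :=
  match fam with
  | .bdm => BDM d l
  | .bdfm => BDFM d l T

/-- `u ∈ H(div; Ω)`: `u` is square integrable and has a square integrable weak divergence. -/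
def MemHDiv {d : ℕ} (Ω : Set (E d)) (u : E d → E d) : Prop :=
  MemLp u 2 (volume.restrict Ω) ∧
    ∃ g : E d → ℝ, MemLp g 2 (volume.restrict Ω) ∧
      ∀ φ : E d → ℝ, ContDiff ℝ ∞ φ → HasCompactSupport φ → tsupport φ ⊆ Ω →
        (∫ x in Ω, fderiv ℝ φ x (u x)) = -(∫ x in Ω, g x * φ x)

/-- `u ∈ H(div; Ω)` belongs on each element `T` to the local space `S T` (as a polynomial on the
interior of `T`), and `u ⬝ n = 0` on `∂Ω`. -/
def MemVec {d : ℕ} {Ω : Set (E d)} (M : Triangulation d Ω) (S : Finset (E d) → Set (E d → E d))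
    (u : E d → E d) : Prop :=
  MemHDiv Ω u ∧ (∀ T ∈ M.cells, ∃ P ∈ S T, EqOn u P (openCell T)) ∧
    ∀ e ∈ M.sides, ¬ M.IsInteriorSide e → ∀ x ∈ hull e,
      inner ℝ (trace (M.cell₁ e) u x) (outerNormal (M.cell₁ e) e) = 0

/-- `p ∈ L²(Ω)` is a polynomial of degree at most `k` on each element and has mean zero. -/
def MemPressure {d : ℕ} {Ω : Set (E d)} (M : Triangulation d Ω) (k : ℕ) (p : E d → ℝ) : Prop :=
  MemLp p 2 (volume.restrict Ω) ∧ (∀ T ∈ M.cells, ∃ P, IsPoly k P ∧ EqOn p P (openCell T)) ∧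
    (∫ x in Ω, p x) = 0

/-- A tuple `(u; v; u̇; v̇; p)` of fields, where `v`, `v̇`, `p` have one component per network. -/
structure Fields (d n : ℕ) where
  u : E d → E d
  v : Fin n → E d → E d
  du : E d → E d
  dv : Fin n → E d → E d
  p : Fin n → E d → ℝ

/-- The tuple belongs to the product of the finite element spaces: `BDM_l` or `BDFM_l` for `u` and
the `v_i`, `RT_{l-1}` for `u̇` and the `v̇_i`, and `P_{l-1}` for the `p_i`. -/
def Fields.Mem {d n : ℕ} {Ω : Set (E d)} (X : Fields d n) (M : Triangulation d Ω) (fam : Family)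
    (l : ℕ) : Prop :=
  MemVec M (fam.space d l) X.u ∧ (∀ i, MemVec M (fam.space d l) (X.v i)) ∧
    MemVec M (fun _ => RT d (l - 1)) X.du ∧ (∀ i, MemVec M (fun _ => RT d (l - 1)) (X.dv i)) ∧
    ∀ i, MemPressure M (l - 1) (X.p i)

/-! ### Parameters -/

/-- The parameters of the model with `n` networks and the time step: time step `τ`, Lamé parameters
`mu` and `lam`, solid density `ρs`, and for each network the fluid density `ρ`, effective density
`ρm`, porosity `φ`, Biot-Willis parameter `αt`, hydraulic conductivity `K`, storage coefficient `cp`,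
and the transfer coefficients `βt`. -/
structure Params (n : ℕ) where
  τ : ℝ
  mu : ℝ
  lam : ℝ
  ρs : ℝ
  ρ : Fin n → ℝ
  ρm : Fin n → ℝ
  φ : Fin n → ℝ
  αt : Fin n → ℝ
  K : Fin n → ℝ
  cp : Fin n → ℝ
  βt : Fin n → Fin n → ℝ

namespace Params

variable {n : ℕ}

/-- The ranges of the parameters. -/
structure Admissible (P : Params n) : Prop where
  τ_pos : 0 < P.τ
  mu_pos : 0 < P.mu
  lam_nonneg : 0 ≤ P.lam
  ρs_pos : 0 < P.ρs
  ρ_pos : ∀ i, 0 < P.ρ i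
  φ_mem : ∀ i, P.φ i ∈ Ioo (0 : ℝ) 1
  sum_φ_mem : ∑ i, P.φ i ∈ Ioo (0 : ℝ) 1
  ρm_ge : ∀ i, P.ρ i / P.φ i ≤ P.ρm i
  αt_mem : ∀ i, P.αt i ∈ Icc (P.φ i) 1
  K_pos : ∀ i, 0 < P.K i
  cp_nonneg : ∀ i, 0 ≤ P.cp i
  βt_nonneg : ∀ i j, i ≠ j → 0 ≤ P.βt i j
  βt_symm : ∀ i j, P.βt i j = P.βt j i

/-- `α_i = α̃_i - φ_i`. -/
def α (P : Params n) (i : Fin n) : ℝ := P.αt i - P.φ i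

/-- `γ_i`. -/
def γ (P : Params n) (i : Fin n) : ℝ :=
  -((P.ρ i - P.φ i * P.ρm i) - P.τ / 2 * P.φ i * (P.K i)⁻¹)

/-- `γ_u`. -/
def γu (P : Params n) : ℝ := (1 - ∑ i, P.φ i) * P.ρs + 1 + ∑ i, P.φ i * P.γ i

/-- `γ_{v,i}`. -/
def γv (P : Params n) (i : Fin n) : ℝ := (P.ρ i + P.γ i) / P.φ i + 1

/-- The block matrix with blocks `γ_u`, `Ā₁₂ = (-γ_i)`, `Ā₂₁`, `Ā₂₂ = diag(γ_{v,i})`. -/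
def Abar (P : Params n) : Matrix (Unit ⊕ Fin n) (Unit ⊕ Fin n) ℝ :=
  Matrix.fromBlocks (Matrix.of fun _ _ => P.γu) (Matrix.of fun _ i => -P.γ i)
    (Matrix.of fun i _ => -P.γ i) (Matrix.diagonal P.γv)

/-- The matrix `Λ_{uv}`, acting on `(u, v, u̇, v̇)`. -/
def Λuv (P : Params n) :
    Matrix ((Unit ⊕ Fin n) ⊕ (Unit ⊕ Fin n)) ((Unit ⊕ Fin n) ⊕ (Unit ⊕ Fin n)) ℝ :=
  Matrix.fromBlocks P.Abar (-(P.τ / 2) • 1) (-(P.τ / 2) • 1) ((P.τ ^ 2 / 4) • 1)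

/-- The transfer matrix, with `β̃_{ij}` off the diagonal and `-∑_{j ≠ i} β̃_{ij}` on it. -/
def L33 (P : Params n) : Matrix (Fin n) (Fin n) ℝ :=
  Matrix.of fun i j => if i = j then -∑ k ∈ Finset.univ.erase i, P.βt i k else P.βt i j

/-- `Λ₁`. -/
def Λ1 (P : Params n) : Matrix (Fin n) (Fin n) ℝ :=
  -((P.τ / 2) • P.L33 + Matrix.diagonal fun i => -P.cp i)

/-- `Λ₂`. -/
def Λ2 (P : Params n) : Matrix (Fin n) (Fin n) ℝ := (P.τ ^ 2 / 4) • (Matrix.diagonal P.γv)⁻¹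

/-- `γ`. -/
def γmax (P : Params n) : ℝ := max (max (P.τ ^ 2 * P.mu / 2) (P.τ ^ 2 * P.lam / 4)) P.γu

/-- `Λ₃`, where the middle factor is the matrix of ones. -/
def Λ3 (P : Params n) : Matrix (Fin n) (Fin n) ℝ :=
  (P.τ ^ 2 / (4 * P.γmax)) •
    (Matrix.diagonal P.α * Matrix.of (fun _ _ => (1 : ℝ)) * Matrix.diagonal P.α)

/-- `Λ = Λ₁ + Λ₂ + Λ₃`. -/
def Λ (P : Params n) : Matrix (Fin n) (Fin n) ℝ := P.Λ1 + P.Λ2 + P.Λ3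

end Params

/-! ### The bilinear form and the norms -/

section Forms

variable {d n : ℕ}

/-- The column `(u, v, u̇, v̇)`. -/
def Fields.stack (X : Fields d n) : (Unit ⊕ Fin n) ⊕ (Unit ⊕ Fin n) → E d → E d :=
  Sum.elim (Sum.elim (fun _ => X.u) X.v) (Sum.elim (fun _ => X.du) X.dv)

/-- `Div v + α \underline{Div} u`, that is `(div v_i + α_i div u)_i`. -/
def Fields.totalDiv (X : Fields d n) (P : Params n) (i : Fin n) (x : E d) : ℝ :=
  div (X.v i) x + P.α i * div X.u x

/-- `(A X, Y)` for columns of vector fields, with the `L²(Ω)` inner product. -/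
def vecForm {ι : Type*} [Fintype ι] (Ω : Set (E d)) (A : Matrix ι ι ℝ) (X Y : ι → E d → E d) : ℝ :=
  ∫ x in Ω, ∑ a, inner ℝ (∑ b, A a b • X b x) (Y a x)

/-- `(A p, q)` for columns of scalar functions, with the `L²(Ω)` inner product. -/
def scalForm {ι : Type*} [Fintype ι] (Ω : Set (E d)) (A : Matrix ι ι ℝ) (p q : ι → E d → ℝ) : ℝ :=
  ∫ x in Ω, (A *ᵥ fun j => p j x) ⬝ᵥ fun i => q i x

/-- The discrete bilinear form. -/
def AForm {Ω : Set (E d)} (M : Triangulation d Ω) (η : ℝ) (P : Params n) (X Y : Fields d n) : ℝ :=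
  P.mu * P.τ ^ 2 / 2 * aForm M η X.u Y.u
    + P.τ ^ 2 * P.lam / 4 * (∫ x in Ω, div X.u x * div Y.u x)
    + vecForm Ω P.Λuv X.stack Y.stack
    - P.τ ^ 2 / 4 * (∫ x in Ω, ∑ i, X.p i x * Y.totalDiv P i x)
    - P.τ ^ 2 / 4 * (∫ x in Ω, ∑ i, X.totalDiv P i x * Y.p i x)
    - P.τ ^ 2 / 4 * scalForm Ω P.Λ1 X.p Y.p

/-- The mesh-dependent norm of `(u; v; u̇; v̇)`. Here `‖A^{1/2} z‖² = (A z, z)` for a positive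
semidefinite matrix `A`. -/
def normUV {Ω : Set (E d)} (M : Triangulation d Ω) (P : Params n) (X : Fields d n) : ℝ :=
  Real.sqrt (P.mu * P.τ ^ 2 / 2 * dgSq M X.u
    + P.τ ^ 2 * P.lam / 4 * (∫ x in Ω, div X.u x ^ 2)
    + vecForm Ω P.Λuv X.stack X.stack
    + P.τ ^ 2 / 4 * scalForm Ω (P.Λ)⁻¹ (X.totalDiv P) (X.totalDiv P))

/-- The norm of `p`, induced by the inner product `(τ² / 4) (Λ p, q)`. -/
def normP (Ω : Set (E d)) (P : Params n) (X : Fields d n) : ℝ :=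
  Real.sqrt (P.τ ^ 2 / 4 * scalForm Ω P.Λ X.p X.p)

end Forms

end MPET

end

open scoped Topology

namespace MPET

/-! ### Young's inequality -/

/-! Every contribution to $\mathcal A_h(x,y)$ is bounded in the additive form $\theta\,(\dots
x\dots)+\theta^{-1}(\dots y\dots)$, with squared norms and one common weight $\theta>0$. Such bounds
simply add up, and choosing $\theta$ at the very end (`le_two_mul_of_forall_young`) turns their sum
into a product of norms. No Cauchy–Schwarz inequality for the separate forms is needed.

The algebraic terms are semidefinite forms. `Λuv_quadForm_eq` writes the form of `Λuv` as a sum of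
squares, so it obeys Young's inequality. The pairings of pressures with divergences are controlled
by the duality between $\Lambda$ and $\Lambda^{-1}$ (`abs_dotProduct_le_young_inv`), and the
$\Lambda_1$ term by $\Lambda_1\le\Lambda$.

The analytic part is the consistency terms of $a_h$. Young's inequality with weight $\theta h_e$
leaves $h_e\|\{\epsilon(u)\}\|_{0,e}^2$ to be bounded. The trace inequality
`exists_trace_inequality` gives $H\|G\|_{0,e}^2\le(d+1)\|G\|_{0,T}^2+h_T^2\|\nabla G\|_{0,T}^2$,
where $H$ is the height of $T$ over $e$. It is proved by integrating along rays from the opposite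
vertex. An inscribed ball has diameter at most $H$, so $h_e\le|\sigma|H$. Taking $G=\partial_ju_i$
produces second derivatives, and the DG norm contains them. No inverse inequality enters, only
smoothness on each element, so the constant does not see the polynomial degree. -/

theorem le_two_mul_of_forall_young {N₁ N₂ x : ℝ} (h₁ : 0 ≤ N₁) (h₂ : 0 ≤ N₂)
    (h : ∀ θ : ℝ, 0 < θ → x ≤ θ * N₁ ^ 2 + θ⁻¹ * N₂ ^ 2) : x ≤ 2 * N₁ * N₂ := by
  -- The optimal weight is $N_2/N_1$; the shift by $\delta$ covers vanishing norms and is removed in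
  -- the limit.
  have key : ∀ δ : ℝ, 0 < δ → x ≤ 2 * (N₁ + δ) * (N₂ + δ) := by
    intro δ hδ
    have hp : 0 < N₁ + δ := by linarith
    have hq : 0 < N₂ + δ := by linarith
    refine (h ((N₂ + δ) / (N₁ + δ)) (by positivity)).trans ?_
    have e₁ : (N₂ + δ) / (N₁ + δ) * N₁ ^ 2 ≤ (N₂ + δ) / (N₁ + δ) * (N₁ + δ) ^ 2 := by
      gcongr; linarith
    have e₂ : ((N₂ + δ) / (N₁ + δ))⁻¹ * N₂ ^ 2 ≤ ((N₂ + δ) / (N₁ + δ))⁻¹ * (N₂ + δ) ^ 2 := by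
      gcongr; linarith
    have e₃ : (N₂ + δ) / (N₁ + δ) * (N₁ + δ) ^ 2 + ((N₂ + δ) / (N₁ + δ))⁻¹ * (N₂ + δ) ^ 2
        = 2 * (N₁ + δ) * (N₂ + δ) := by
      field_simp; ring
    linarith
  have hc : Filter.Tendsto (fun δ : ℝ => 2 * (N₁ + δ) * (N₂ + δ)) (nhdsWithin 0 (Ioi 0))
      (nhds (2 * (N₁ + 0) * (N₂ + 0))) := by
    apply Filter.Tendsto.mono_left _ nhdsWithin_le_nhds
    exact Continuous.tendsto (by fun_prop) 0
  have := ge_of_tendsto hc (by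
    filter_upwards [self_mem_nhdsWithin] with δ hδ using key δ hδ)
  simpa using this

theorem abs_inner_le_young {V : Type*} [NormedAddCommGroup V] [InnerProductSpace ℝ V] (x y : V)
    {θ : ℝ} (hθ : 0 < θ) : |inner ℝ x y| ≤ θ * ‖x‖ ^ 2 + θ⁻¹ * ‖y‖ ^ 2 := by
  refine (abs_real_inner_le_norm x y).trans ?_
  have h : 0 ≤ θ⁻¹ * (θ * ‖x‖ - ‖y‖) ^ 2 := by positivity
  have h' : θ⁻¹ * (θ * ‖x‖ - ‖y‖) ^ 2 = θ * ‖x‖ ^ 2 - 2 * (‖x‖ * ‖y‖) + θ⁻¹ * ‖y‖ ^ 2 := by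
    field_simp
    ring
  have : 0 ≤ ‖x‖ * ‖y‖ := by positivity
  linarith

theorem abs_mul_le_young (x y : ℝ) {θ : ℝ} (hθ : 0 < θ) :
    |x * y| ≤ θ * x ^ 2 + θ⁻¹ * y ^ 2 := by
  have := abs_inner_le_young x y hθ
  simpa [mul_comm] using this

/-! ### Young inequalities for semidefinite quadratic forms. -/

section PosSemidef

variable {ι : Type*} [Fintype ι] {A : Matrix ι ι ℝ}

theorem mulVec_dotProduct_self_nonneg (hA : A.PosSemidef) (x : ι → ℝ) :
    0 ≤ (A *ᵥ x) ⬝ᵥ x := by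
  have := hA.dotProduct_mulVec_nonneg x
  rwa [star_trivial, dotProduct_comm] at this

theorem mulVec_dotProduct_symm (hA : A.PosSemidef) (x y : ι → ℝ) :
    (A *ᵥ x) ⬝ᵥ y = (A *ᵥ y) ⬝ᵥ x := by
  have h : Aᵀ = A := by simpa using hA.isHermitian.eq
  rw [dotProduct_comm, Matrix.dotProduct_mulVec, ← Matrix.mulVec_transpose, h]

/-- Nonnegativity of the form at $\theta x\pm y$, divided by $\theta$, gives this even with a factor
2 to spare. -/
theorem abs_mulVec_dotProduct_le_young (hA : A.PosSemidef) (x y : ι → ℝ) {θ : ℝ} (hθ : 0 < θ) :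
    |(A *ᵥ x) ⬝ᵥ y| ≤ θ * ((A *ᵥ x) ⬝ᵥ x) + θ⁻¹ * ((A *ᵥ y) ⬝ᵥ y) := by
  have hx := mulVec_dotProduct_self_nonneg hA x
  have hy := mulVec_dotProduct_self_nonneg hA y
  have h₁ := mulVec_dotProduct_self_nonneg hA (θ • x + y)
  have h₂ := mulVec_dotProduct_self_nonneg hA (θ • x - y)
  simp only [Matrix.mulVec_add, Matrix.mulVec_sub, Matrix.mulVec_smul, dotProduct_add,
    dotProduct_sub, add_dotProduct, sub_dotProduct, smul_dotProduct, dotProduct_smul,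
    smul_eq_mul, mulVec_dotProduct_symm hA y x] at h₁ h₂
  set a := (A *ᵥ x) ⬝ᵥ x
  set b := (A *ᵥ x) ⬝ᵥ y
  set c := (A *ᵥ y) ⬝ᵥ y
  have hc : θ * (θ⁻¹ * c) = c := by field_simp
  have hi : 0 ≤ θ⁻¹ * c := by positivity
  have ha : 0 ≤ θ * a := by positivity
  rw [abs_le]
  constructor
  · nlinarith
  · nlinarith

/-- Since $A$ mixes the fields but not their spatial coordinates, statements on columns of vectors
reduce to scalar columns, one for each coordinate. -/
theorem inner_sum_smul_eq {d : ℕ} (A : Matrix ι ι ℝ) (X Y : ι → E d) :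
    ∑ a, inner ℝ (∑ b, A a b • X b) (Y a)
      = ∑ k, (A *ᵥ fun b => X b k) ⬝ᵥ fun a => Y a k := by
  simp only [PiLp.inner_apply, RCLike.inner_apply, conj_trivial, dotProduct, Matrix.mulVec]
  rw [Finset.sum_comm]
  refine Finset.sum_congr rfl fun k _ => Finset.sum_congr rfl fun a _ => ?_
  simp [mul_comm]

theorem inner_sum_smul_self_nonneg {d : ℕ} (hA : A.PosSemidef) (X : ι → E d) :
    0 ≤ ∑ a, inner ℝ (∑ b, A a b • X b) (X a) := by
  rw [inner_sum_smul_eq]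
  exact Finset.sum_nonneg fun k _ => mulVec_dotProduct_self_nonneg hA _

theorem abs_inner_sum_smul_le_young {d : ℕ} (hA : A.PosSemidef) (X Y : ι → E d) {θ : ℝ}
    (hθ : 0 < θ) :
    |∑ a, inner ℝ (∑ b, A a b • X b) (Y a)|
      ≤ θ * (∑ a, inner ℝ (∑ b, A a b • X b) (X a))
        + θ⁻¹ * (∑ a, inner ℝ (∑ b, A a b • Y b) (Y a)) := by
  simp only [inner_sum_smul_eq]
  refine (Finset.abs_sum_le_sum_abs _ _).trans ?_
  rw [Finset.mul_sum, Finset.mul_sum, ← Finset.sum_add_distrib]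
  exact Finset.sum_le_sum fun k _ => abs_mulVec_dotProduct_le_young hA _ _ hθ

/-- Young's inequality for the duality between the norms of `A` and `A⁻¹`. -/
theorem abs_dotProduct_le_young_inv [DecidableEq ι] (hA : A.PosDef) (x y : ι → ℝ) {θ : ℝ}
    (hθ : 0 < θ) :
    |x ⬝ᵥ y| ≤ θ * ((A *ᵥ x) ⬝ᵥ x) + θ⁻¹ * ((A⁻¹ *ᵥ y) ⬝ᵥ y) := by
  -- The pairing of $x$ with $y$ is the $A$-form of $x$ and $A^{-1}y$, and the $A$-energy of
  -- $A^{-1}y$ is the $A^{-1}$-energy of $y$.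
  have hy : A *ᵥ (A⁻¹ *ᵥ y) = y := by
    rw [Matrix.mulVec_mulVec, Matrix.mul_nonsing_inv _ ((Matrix.isUnit_iff_isUnit_det A).1 hA.isUnit),
      Matrix.one_mulVec]
  have h := abs_mulVec_dotProduct_le_young hA.posSemidef x (A⁻¹ *ᵥ y) hθ
  rwa [mulVec_dotProduct_symm hA.posSemidef x, hy, dotProduct_comm y x,
    dotProduct_comm y (A⁻¹ *ᵥ y)] at h

end PosSemidef

/-! ### Positivity of the parameter matrices -/

namespace Params

variable {n : ℕ} {P : Params n}

/-- The bound $\rho_{m_i}\ge\rho_i/\varphi_i$ makes the density part nonnegative, and the term with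
$K_i^{-1}$ is strictly positive. -/
theorem γ_pos (hP : P.Admissible) (i : Fin n) : 0 < P.γ i := by
  have hφ := (hP.φ_mem i).1
  have h₁ := (div_le_iff₀ hφ).1 (hP.ρm_ge i)
  have h₂ : 0 < P.τ / 2 * P.φ i * (P.K i)⁻¹ := by
    have := hP.τ_pos
    have := inv_pos.2 (hP.K_pos i)
    positivity
  unfold γ
  nlinarith

theorem γv_pos (hP : P.Admissible) (i : Fin n) : 0 < P.γv i := by
  have := γ_pos hP i
  have := hP.ρ_pos i
  have := (hP.φ_mem i).1
  unfold γv
  positivity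

theorem γmax_pos (hP : P.Admissible) : 0 < P.γmax := by
  have := hP.τ_pos
  have := hP.mu_pos
  exact lt_of_lt_of_le (by positivity) ((le_max_left _ _).trans (le_max_left _ _))

theorem isHermitian_Λuv (P : Params n) : P.Λuv.IsHermitian := by
  unfold Λuv Abar
  rw [Matrix.isHermitian_fromBlocks_iff]
  refine ⟨?_, ?_, ?_⟩
  · rw [Matrix.isHermitian_fromBlocks_iff]
    refine ⟨?_, ?_, ?_, ?_⟩
    · ext; simp
    · ext; simp
    · ext; simp
    · exact Matrix.isHermitian_diagonal _
  · simp
  · simp [Matrix.IsHermitian]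

/-- Completing squares: the summands 1 in `γu` and `γv` combine with the blocks $-\frac\tau2I$ and
$\frac{\tau^2}4I$ into the squares with $\tau/2$. The couplings $-\gamma_i$ use up the
$\varphi_i\gamma_i$ of `γu` and the $\gamma_i/\varphi_i$ of `γv`. -/
theorem Λuv_quadForm_eq (hP : P.Admissible) (x : (Unit ⊕ Fin n) ⊕ (Unit ⊕ Fin n) → ℝ) :
    x ⬝ᵥ P.Λuv *ᵥ x
      = (1 - ∑ i, P.φ i) * P.ρs * x (.inl (.inl ())) ^ 2
        + (x (.inl (.inl ())) - P.τ / 2 * x (.inr (.inl ()))) ^ 2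
        + ∑ i, (P.γ i / P.φ i * (P.φ i * x (.inl (.inl ())) - x (.inl (.inr i))) ^ 2
          + P.ρ i / P.φ i * x (.inl (.inr i)) ^ 2
          + (x (.inl (.inr i)) - P.τ / 2 * x (.inr (.inr i))) ^ 2) := by
  set s := x (.inl (.inl ()))
  set t := x (.inr (.inl ()))
  have h : x ⬝ᵥ P.Λuv *ᵥ x = P.γu * s ^ 2 - P.τ * s * t + P.τ ^ 2 / 4 * t ^ 2
      + ∑ i, (P.γv i * x (.inl (.inr i)) ^ 2 - 2 * s * (P.γ i * x (.inl (.inr i)))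
        - P.τ * x (.inl (.inr i)) * x (.inr (.inr i))
        + P.τ ^ 2 / 4 * x (.inr (.inr i)) ^ 2) := by
    simp only [dotProduct, Matrix.mulVec, Fintype.sum_sum_type, Λuv, Abar, Finset.univ_unique,
      Finset.sum_singleton, PUnit.default_eq_unit, Matrix.fromBlocks_apply₁₁,
      Matrix.fromBlocks_apply₁₂, Matrix.fromBlocks_apply₂₁, Matrix.fromBlocks_apply₂₂,
      Matrix.of_apply, Matrix.diagonal_apply, Matrix.smul_apply, Matrix.one_apply, smul_eq_mul,
      Sum.inr.injEq, reduceCtorEq, if_false, if_true, mul_zero, zero_mul,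
      Finset.sum_const_zero, add_zero, zero_add, mul_ite, ite_mul, mul_one, Finset.sum_ite_eq,
      Finset.mem_univ]
    change s * (P.γu * s + ∑ i, -P.γ i * x (.inl (.inr i)) + -(P.τ / 2) * t)
      + ∑ i, x (.inl (.inr i)) * (-P.γ i * s + P.γv i * x (.inl (.inr i))
        + -(P.τ / 2) * x (.inr (.inr i)))
      + (t * (-(P.τ / 2) * s + P.τ ^ 2 / 4 * t) + ∑ i, x (.inr (.inr i)) *
        (-(P.τ / 2) * x (.inl (.inr i)) + P.τ ^ 2 / 4 * x (.inr (.inr i)))) = _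
    rw [mul_add, mul_add, Finset.mul_sum]
    have : ∀ a b c e : Fin n → ℝ, (∀ i, a i + b i + c i = e i) →
        ∑ i, a i + ∑ i, b i + ∑ i, c i = ∑ i, e i := fun a b c e h => by
      rw [← Finset.sum_add_distrib, ← Finset.sum_add_distrib]
      exact Finset.sum_congr rfl fun i _ => h i
    linear_combination this (fun i => s * (-P.γ i * x (.inl (.inr i))))
      (fun i => x (.inl (.inr i)) * (-P.γ i * s + P.γv i * x (.inl (.inr i))
        + -(P.τ / 2) * x (.inr (.inr i))))
      (fun i => x (.inr (.inr i)) *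
        (-(P.τ / 2) * x (.inl (.inr i)) + P.τ ^ 2 / 4 * x (.inr (.inr i))))
      (fun i => P.γv i * x (.inl (.inr i)) ^ 2 - 2 * s * (P.γ i * x (.inl (.inr i)))
        - P.τ * x (.inl (.inr i)) * x (.inr (.inr i))
        + P.τ ^ 2 / 4 * x (.inr (.inr i)) ^ 2) (fun i => by ring)
  have h' : ∑ i, (P.γ i / P.φ i * (P.φ i * s - x (.inl (.inr i))) ^ 2
          + P.ρ i / P.φ i * x (.inl (.inr i)) ^ 2
          + (x (.inl (.inr i)) - P.τ / 2 * x (.inr (.inr i))) ^ 2)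
      = s ^ 2 * ∑ i, P.φ i * P.γ i
        + ∑ i, (P.γv i * x (.inl (.inr i)) ^ 2 - 2 * s * (P.γ i * x (.inl (.inr i)))
        - P.τ * x (.inl (.inr i)) * x (.inr (.inr i))
        + P.τ ^ 2 / 4 * x (.inr (.inr i)) ^ 2) := by
    rw [Finset.mul_sum, ← Finset.sum_add_distrib]
    refine Finset.sum_congr rfl fun i _ => ?_
    have := (hP.φ_mem i).1.ne'
    unfold γv
    field_simp
    ring
  rw [h, h', γu]
  ring

theorem posSemidef_Λuv (hP : P.Admissible) : P.Λuv.PosSemidef := by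
  refine Matrix.PosSemidef.of_dotProduct_mulVec_nonneg P.isHermitian_Λuv fun x => ?_
  rw [star_trivial, Λuv_quadForm_eq hP]
  have hρs := hP.ρs_pos
  have hφ : 0 < 1 - ∑ i, P.φ i := by linarith [hP.sum_φ_mem.2]
  have : ∀ i, 0 ≤ P.γ i / P.φ i * (P.φ i * x (.inl (.inl ())) - x (.inl (.inr i))) ^ 2
          + P.ρ i / P.φ i * x (.inl (.inr i)) ^ 2
          + (x (.inl (.inr i)) - P.τ / 2 * x (.inr (.inr i))) ^ 2 := fun i => by
    have := γ_pos hP i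
    have := hP.ρ_pos i
    have := (hP.φ_mem i).1
    positivity
  have := Finset.sum_nonneg fun i (_ : i ∈ Finset.univ) => this i
  positivity

/-- The rows sum to zero, so only differences appear. The term $j=i$ vanishes, whatever the value of
`P.βt i i`. -/
theorem L33_mulVec (P : Params n) (x : Fin n → ℝ) (i : Fin n) :
    (P.L33 *ᵥ x) i = ∑ j, P.βt i j * (x j - x i) := by
  have h : ∑ j, P.βt i j * (x j - x i)
      = ∑ j ∈ Finset.univ.erase i, P.βt i j * (x j - x i) := by
    rw [Finset.sum_erase]; simp
  have h' : (P.L33 *ᵥ x) i = P.L33 i i * x i + ∑ j ∈ Finset.univ.erase i, P.L33 i j * x j :=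
    (Finset.add_sum_erase _ (fun j => P.L33 i j * x j) (Finset.mem_univ i)).symm
  have h'' : ∑ j ∈ Finset.univ.erase i, P.L33 i j * x j
      = ∑ j ∈ Finset.univ.erase i, P.βt i j * x j :=
    Finset.sum_congr rfl fun j hj => by
      simp [L33, (Finset.ne_of_mem_erase hj).symm]
  rw [h, h', h'']
  simp only [L33, Matrix.of_apply, if_true, mul_sub, Finset.sum_sub_distrib, neg_mul,
    Finset.sum_mul]
  ring

/-- Averaging the double sum with its transpose gives $-\frac12\sum\tilde\beta_{ij}(x_i-x_j)^2$. -/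
theorem L33_quadForm_nonpos (hP : P.Admissible) (x : Fin n → ℝ) : x ⬝ᵥ P.L33 *ᵥ x ≤ 0 := by
  have h₁ : x ⬝ᵥ P.L33 *ᵥ x = ∑ i, ∑ j, x i * (P.βt i j * (x j - x i)) := by
    simp only [dotProduct, L33_mulVec, Finset.mul_sum]
  have h₂ : x ⬝ᵥ P.L33 *ᵥ x = ∑ i, ∑ j, x j * (P.βt i j * (x i - x j)) := by
    rw [h₁, Finset.sum_comm]
    simp only [hP.βt_symm]
  have h₃ : 0 ≤ ∑ i, ∑ j, P.βt i j * (x i - x j) ^ 2 :=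
    Finset.sum_nonneg fun i _ => Finset.sum_nonneg fun j _ => by
      rcases eq_or_ne i j with rfl | hij
      · simp
      · exact mul_nonneg (hP.βt_nonneg i j hij) (sq_nonneg _)
  have h₄ : x ⬝ᵥ P.L33 *ᵥ x + x ⬝ᵥ P.L33 *ᵥ x = -∑ i, ∑ j, P.βt i j * (x i - x j) ^ 2 := by
    nth_rewrite 1 [h₁]
    rw [h₂]
    simp only [← Finset.sum_add_distrib, ← Finset.sum_neg_distrib]
    exact Finset.sum_congr rfl fun i _ => Finset.sum_congr rfl fun j _ => by ring
  linarith

theorem posSemidef_Λ1 (hP : P.Admissible) : P.Λ1.PosSemidef := by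
  refine Matrix.PosSemidef.of_dotProduct_mulVec_nonneg ?_ fun x => ?_
  · ext i j
    rcases eq_or_ne i j with rfl | hij
    · simp
    · simp [Λ1, L33, hij, hij.symm, hP.βt_symm i j]
  · have hL := L33_quadForm_nonpos hP x
    have hτ := hP.τ_pos
    have hc : 0 ≤ x ⬝ᵥ (Matrix.diagonal P.cp) *ᵥ x := by
      have := (Matrix.PosSemidef.diagonal (d := P.cp) hP.cp_nonneg).dotProduct_mulVec_nonneg x
      rwa [star_trivial] at this
    have hd : (Matrix.diagonal fun i => -P.cp i) = -Matrix.diagonal P.cp := by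
      rw [Matrix.diagonal_neg]
    rw [star_trivial, Λ1, hd, Matrix.neg_mulVec, Matrix.add_mulVec, Matrix.smul_mulVec,
      Matrix.neg_mulVec, dotProduct_neg, dotProduct_add, dotProduct_smul, dotProduct_neg,
      smul_eq_mul]
    nlinarith

theorem posDef_Λ2 (hP : P.Admissible) : P.Λ2.PosDef := by
  have hτ := hP.τ_pos
  exact (Matrix.PosDef.diagonal fun i => γv_pos hP i).inv.smul (by positivity)

theorem posSemidef_Λ3 (hP : P.Admissible) : P.Λ3.PosSemidef := by
  have hτ := hP.τ_pos
  have hγ := γmax_pos hP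
  have h : Matrix.diagonal P.α * Matrix.of (fun _ _ => (1 : ℝ)) * Matrix.diagonal P.α
      = Matrix.vecMulVec P.α (star P.α) := by
    ext i j
    simp [Matrix.vecMulVec_apply]
  unfold Λ3
  rw [h]
  exact (Matrix.posSemidef_vecMulVec_self_star P.α).smul (by positivity)

theorem posDef_Λ (hP : P.Admissible) : P.Λ.PosDef :=
  ((posDef_Λ2 hP).posSemidef_add (posSemidef_Λ1 hP)).add_posSemidef (posSemidef_Λ3 hP)

theorem Λ1_mulVec_dotProduct_le (hP : P.Admissible) (x : Fin n → ℝ) :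
    (P.Λ1 *ᵥ x) ⬝ᵥ x ≤ (P.Λ *ᵥ x) ⬝ᵥ x := by
  have h₂ := mulVec_dotProduct_self_nonneg (posDef_Λ2 hP).posSemidef x
  have h₃ := mulVec_dotProduct_self_nonneg (posSemidef_Λ3 hP) x
  rw [Λ, Matrix.add_mulVec, Matrix.add_mulVec, add_dotProduct, add_dotProduct]
  linarith

end Params

/-! ### The trace inequality on a simplex -/

section Trace

variable {m : ℕ}

theorem lintegral_eq_smul_lintegral_comp_smul {V : Type*} [NormedAddCommGroup V] [NormedSpace ℝ V]
    [MeasurableSpace V] [BorelSpace V] [FiniteDimensional ℝ V] (μ : Measure V)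
    [μ.IsAddHaarMeasure] {f : V → ENNReal} (hf : Measurable f) {t : ℝ} (ht : 0 < t) :
    ∫⁻ y, f y ∂μ = ENNReal.ofReal (t ^ Module.finrank ℝ V) * ∫⁻ y, f (t • y) ∂μ := by
  rw [← lintegral_map hf (measurable_const_smul t), Measure.map_addHaar_smul μ ht.ne',
    lintegral_smul_measure, smul_eq_mul, ← mul_assoc, ← ENNReal.ofReal_mul (by positivity),
    abs_of_pos (by positivity), mul_inv_cancel₀ (by positivity), ENNReal.ofReal_one, one_mul]

/-- The orthogonal coordinates with origin `a` and axes `b`. -/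
noncomputable def coords (b : OrthonormalBasis (Fin (m + 1)) ℝ (E (m + 1)))
    (a : E (m + 1)) (z : ℝ × E m) : E (m + 1) :=
  a + b.repr.symm (WithLp.toLp 2 (Fin.cons z.1 z.2.ofLp))

variable (b : OrthonormalBasis (Fin (m + 1)) ℝ (E (m + 1))) (a : E (m + 1))

theorem measurePreserving_coords : MeasurePreserving (coords b a) := by
  have h₁ : MeasurePreserving (fun z : ℝ × E m => (z.1, z.2.ofLp)) :=
    (MeasurePreserving.id volume).prod (PiLp.volume_preserving_ofLp (Fin m))
  have h₂ : MeasurePreserving (fun z : ℝ × (Fin m → ℝ) => (Fin.cons z.1 z.2 : Fin (m + 1) → ℝ)) := by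
    have := (volume_preserving_piFinSuccAbove (fun _ : Fin (m + 1) => ℝ) 0).symm
    convert this using 1
    ext z i
    simp [MeasurableEquiv.piFinSuccAbove]
  exact (measurePreserving_add_left volume a).comp
    (b.measurePreserving_repr_symm.comp ((PiLp.volume_preserving_toLp (Fin (m + 1))).comp
      (h₂.comp h₁)))

theorem coords_smul (t s : ℝ) (y : E m) :
    coords b a (t * s, t • y) = a + t • (coords b a (s, y) - a) := by
  have : (WithLp.toLp 2 (Fin.cons (t * s) (t • y).ofLp) : E (m + 1))
      = t • WithLp.toLp 2 (Fin.cons s y.ofLp) := by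
    ext i
    refine Fin.cases ?_ (fun i => ?_) i <;> simp
  rw [coords, this, map_smul, coords, add_sub_cancel_left]

theorem isometry_coords (s : ℝ) : Isometry fun y => coords b a (s, y) := by
  refine Isometry.of_dist_eq fun y z => ?_
  simp only [coords, dist_add_left, LinearIsometryEquiv.dist_map]
  simp [EuclideanSpace.dist_eq, Fin.sum_univ_succ]

theorem coords_surj (x : E (m + 1)) : ∃ y, coords b a (inner ℝ (b 0) (x - a), y) = x := by
  refine ⟨WithLp.toLp 2 (Fin.tail (b.repr (x - a)).ofLp), ?_⟩
  have h : (Fin.cons (inner ℝ (b 0) (x - a)) (Fin.tail (b.repr (x - a)).ofLp) : Fin (m + 1) → ℝ)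
      = (b.repr (x - a)).ofLp := by
    rw [← b.repr_apply_apply]
    exact Fin.cons_self_tail _
  rw [coords, h, WithLp.toLp_ofLp, LinearIsometryEquiv.symm_apply_apply, add_sub_cancel]

/-- Integration in polar coordinates over a cone with vertex `a` and base `A` at the height `H`. -/
theorem lintegral_cone_le {A : Set (E m)} {S : Set (E (m + 1))}
    (hA : MeasurableSet A) (hS : MeasurableSet S) {H : ℝ} (hH : 0 < H)
    (hAS : ∀ y ∈ A, ∀ t ∈ Ioc (0 : ℝ) 1, coords b a (t * H, t • y) ∈ S)
    {F : E (m + 1) → ENNReal} (hF : Measurable F) :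
    ENNReal.ofReal H * ∫⁻ y in A, ∫⁻ t in Ioc (0 : ℝ) 1,
        ENNReal.ofReal (t ^ m) * F (coords b a (t * H, t • y))
      ≤ ∫⁻ x in S, F x := by
  have hc : Measurable (coords b a) := (measurePreserving_coords b a).measurable
  set g : ℝ × E m → ENNReal := fun z => S.indicator F (coords b a z) with hg
  have hgm : Measurable g := (hF.indicator hS).comp hc
  have e₁ : ∫⁻ x in S, F x = ENNReal.ofReal H * ∫⁻ t : ℝ, ∫⁻ y, g (t * H, y) := by
    rw [← lintegral_indicator hS, ← (measurePreserving_coords b a).lintegral_comp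
      (hF.indicator hS), Measure.volume_eq_prod, lintegral_prod _ hgm.aemeasurable,
      lintegral_eq_smul_lintegral_comp_smul volume hgm.lintegral_prod_right' hH]
    simp [mul_comm]
  rw [e₁]
  gcongr
  -- The section of the cone at height $tH$ is the base scaled by $t$, with Jacobian $t^m$.
  have e₂ : ∀ t ∈ Ioc (0 : ℝ) 1, ∫⁻ y, g (t * H, y)
      = ∫⁻ y, ENNReal.ofReal (t ^ m) * g (t * H, t • y) := fun t ht => by
    rw [lintegral_eq_smul_lintegral_comp_smul volume (by fun_prop) ht.1, finrank_euclideanSpace_fin,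
      lintegral_const_mul _ (by fun_prop)]
  calc ∫⁻ y in A, ∫⁻ t in Ioc (0 : ℝ) 1, ENNReal.ofReal (t ^ m) * F (coords b a (t * H, t • y))
      = ∫⁻ t in Ioc (0 : ℝ) 1, ∫⁻ y in A,
          ENNReal.ofReal (t ^ m) * F (coords b a (t * H, t • y)) := by
        rw [lintegral_lintegral_swap]
        fun_prop
    _ ≤ ∫⁻ t in Ioc (0 : ℝ) 1, ∫⁻ y, g (t * H, y) := by
        refine setLIntegral_mono' measurableSet_Ioc fun t ht => ?_
        rw [e₂ t ht]
        refine le_trans ?_ (setLIntegral_le_lintegral A _)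
        refine setLIntegral_mono' hA fun y hy => ?_
        simp [hg, indicator_of_mem (hAS y hy t ht)]
    _ ≤ _ := setLIntegral_le_lintegral _ _

/-- Integrate the derivative of $t^{m+1}g^2$, which vanishes at 0, and use $2tgg'\le g^2+t^2g'^2$.
The weight $t^m$ is the Jacobian of the cone coordinates. -/
theorem sq_le_integral_pow_mul (m : ℕ) {g : ℝ → ℝ} (hg : ContDiff ℝ 1 g) :
    g 1 ^ 2 ≤ ∫ t in (0 : ℝ)..1, t ^ m * ((m + 2) * g t ^ 2 + deriv g t ^ 2) := by
  have hg' : Continuous (deriv g) := hg.continuous_deriv (by norm_num)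
  have hgc := hg.continuous
  have h : ∀ t ∈ uIcc (0 : ℝ) 1, HasDerivAt (fun t => t ^ (m + 1) * g t ^ 2)
      (t ^ m * ((m + 1) * g t ^ 2 + 2 * t * g t * deriv g t)) t := fun t _ => by
    have h₁ := (hg.differentiable (by norm_num) t).hasDerivAt
    convert! (hasDerivAt_pow (m + 1) t).mul (h₁.pow 2) using 1
    push_cast
    simp
    ring
  have e := intervalIntegral.integral_eq_sub_of_hasDerivAt h
    (Continuous.intervalIntegrable (by fun_prop) _ _)
  have : g 1 ^ 2 = ∫ t in (0 : ℝ)..1, t ^ m * ((m + 1) * g t ^ 2 + 2 * t * g t * deriv g t) := by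
    rw [e]; simp
  rw [this]
  refine intervalIntegral.integral_mono_on zero_le_one
    (Continuous.intervalIntegrable (by fun_prop) _ _)
    (Continuous.intervalIntegrable (by fun_prop) _ _) fun t ht => ?_
  refine mul_le_mul_of_nonneg_left ?_ (pow_nonneg ht.1 m)
  have h₁ : 0 ≤ (g t - t * deriv g t) ^ 2 := sq_nonneg _
  have h₂ : t ^ 2 * deriv g t ^ 2 ≤ deriv g t ^ 2 := by
    have : t ^ 2 ≤ 1 := pow_le_one₀ ht.1 ht.2
    nlinarith [sq_nonneg (deriv g t)]
  nlinarith

theorem ofReal_sq_le_lintegral_pow_mul (m : ℕ) {g : ℝ → ℝ} (hg : ContDiff ℝ 1 g) :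
    ENNReal.ofReal (g 1 ^ 2) ≤ ∫⁻ t in Ioc (0 : ℝ) 1,
      ENNReal.ofReal (t ^ m) * ENNReal.ofReal ((m + 2) * g t ^ 2 + deriv g t ^ 2) := by
  have hg' : Continuous (deriv g) := hg.continuous_deriv (by norm_num)
  have hgc := hg.continuous
  refine (ENNReal.ofReal_le_ofReal (sq_le_integral_pow_mul m hg)).trans ?_
  rw [intervalIntegral.integral_of_le zero_le_one, ofReal_integral_eq_lintegral_ofReal]
  · refine (setLIntegral_congr_fun measurableSet_Ioc fun t ht => ?_).le
    exact ENNReal.ofReal_mul (pow_nonneg ht.1.le m)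
  · exact (Continuous.integrableOn_Icc (by fun_prop)).mono_set Ioc_subset_Icc_self
  · refine (ae_restrict_iff' measurableSet_Ioc).2 (ae_of_all _ fun t ht => ?_)
    have := pow_nonneg ht.1.le m
    positivity

theorem sq_apply_le {d : ℕ} (L : E d →L[ℝ] ℝ) (v : E d) :
    L v ^ 2 ≤ ‖v‖ ^ 2 * ∑ k, L (EuclideanSpace.single k 1) ^ 2 := by
  have h : L v = ∑ k, v k * L (EuclideanSpace.single k 1) := by
    conv_lhs => rw [← (EuclideanSpace.basisFun (Fin d) ℝ).sum_repr v]
    simp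
  rw [h, EuclideanSpace.real_norm_sq_eq]
  exact Finset.sum_mul_sq_le_sq_mul_sq _ _ _

/-- The one-dimensional inequality is applied on each ray from the apex to a base point and
integrated over the base. The derivative along a ray is at most the ray's length, hence at most $D$,
times $|\nabla G|$. -/
theorem lintegral_base_sq_le {A : Set (E m)} {S : Set (E (m + 1))}
    (hA : MeasurableSet A) (hS : MeasurableSet S) {H D : ℝ} (hH : 0 < H)
    (hAS : ∀ y ∈ A, ∀ t ∈ Ioc (0 : ℝ) 1, coords b a (t * H, t • y) ∈ S)
    (hD : ∀ y ∈ A, ‖coords b a (H, y) - a‖ ≤ D) {G : E (m + 1) → ℝ} (hG : ContDiff ℝ 1 G) :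
    ENNReal.ofReal H * ∫⁻ y in A, ENNReal.ofReal (G (coords b a (H, y)) ^ 2)
      ≤ ∫⁻ x in S, ENNReal.ofReal ((m + 2) * G x ^ 2
          + D ^ 2 * ∑ k, fderiv ℝ G x (EuclideanSpace.single k 1) ^ 2) := by
  have hG' : Continuous (fderiv ℝ G) := hG.continuous_fderiv (by norm_num)
  have hGc := hG.continuous
  refine le_trans ?_ (lintegral_cone_le b a hA hS hH hAS (by
    refine (Continuous.measurable ?_).ennreal_ofReal
    fun_prop))
  gcongr ENNReal.ofReal H * ?_
  refine setLIntegral_mono' hA fun y hy => ?_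
  set v := coords b a (H, y) - a with hv
  have hl : ∀ t : ℝ, HasDerivAt (fun t : ℝ => a + t • v) v t := fun t => by
    simpa using ((hasDerivAt_id t).smul_const v).const_add a
  have hd : ∀ t, deriv (fun t : ℝ => G (a + t • v)) t = fderiv ℝ G (a + t • v) v := fun t =>
    ((hG.differentiable (by norm_num) (a + t • v)).hasFDerivAt.comp_hasDerivAt t (hl t)).deriv
  have h := ofReal_sq_le_lintegral_pow_mul m (g := fun t => G (a + t • v)) (by fun_prop)
  simp only [one_smul, hd] at h
  rw [show a + v = coords b a (H, y) by simp [hv]] at h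
  refine h.trans (lintegral_mono fun t => ?_)
  rw [coords_smul, ← hv]
  gcongr
  refine (sq_apply_le _ v).trans ?_
  gcongr
  exact hD y hy

/-- The hyperplane at height $H$ is an isometric copy of `E m`, on which the normalized Hausdorff
measure is Lebesgue measure. -/
theorem lintegral_slice {B : Set (E (m + 1))} (hB : MeasurableSet B) {H : ℝ}
    (hBH : ∀ x ∈ B, inner ℝ (b 0) (x - a) = H) {f : E (m + 1) → ENNReal} (hf : Measurable f) :
    ∫⁻ x in B, f x ∂(Measure.euclideanHausdorffMeasure m)
      = ∫⁻ y in (fun y => coords b a (H, y)) ⁻¹' B, f (coords b a (H, y)) := by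
  have hi := isometry_coords b a H
  have hm : Measurable fun y => coords b a (H, y) := hi.continuous.measurable
  have hr : B ⊆ range fun y => coords b a (H, y) := fun x hx => by
    obtain ⟨y, hy⟩ := coords_surj b a x
    exact ⟨y, by rw [← hBH x hx]; exact hy⟩
  have h := hi.map_euclideanHausdorffMeasure (d := m)
  rw [EuclideanSpace.euclideanHausdorffMeasure_eq_volume] at h
  rw [← inter_eq_self_of_subset_left hr, ← Measure.restrict_restrict hB, ← h,
    Measure.restrict_map hm hB, lintegral_map hf hm, inter_eq_self_of_subset_left hr]

end Trace

/-! ### Geometry of a simplex seen from the vertex opposite to a side. -/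

section Simplex

variable {d m : ℕ}

theorem isCompact_hull (s : Finset (E d)) : IsCompact (hull s) :=
  s.finite_toSet.isCompact_convexHull ℝ

theorem convex_hull (s : Finset (E d)) : Convex ℝ (hull s) := convex_convexHull ℝ _

theorem hull_mono {s t : Finset (E d)} (h : s ⊆ t) : hull s ⊆ hull t :=
  convexHull_mono (by exact_mod_cast h)

theorem subset_hull (s : Finset (E d)) : (s : Set (E d)) ⊆ hull s := subset_convexHull ℝ _

theorem size_mono {s t : Finset (E d)} (h : s ⊆ t) : size s ≤ size t :=
  Metric.diam_mono (hull_mono h) (isCompact_hull t).isBounded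

theorem size_nonneg (s : Finset (E d)) : 0 ≤ size s := Metric.diam_nonneg

theorem size_pos {s : Finset (E d)} (h : 1 < s.card) : 0 < size s := by
  obtain ⟨x, hx, y, hy, hxy⟩ := Finset.one_lt_card.1 h
  exact (dist_pos.2 hxy).trans_le (Metric.dist_le_diam_of_mem (isCompact_hull s).isBounded
    (subset_hull s hx) (subset_hull s hy))

theorem affineSpan_eq_top {T : Finset (E d)} (hT : AffineIndependent ℝ ((↑) : T → E d))
    (hc : T.card = d + 1) : affineSpan ℝ (range ((↑) : T → E d)) = ⊤ :=
  hT.affineSpan_eq_top_iff_card_eq_finrank_add_one.2 (by simp [hc])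

theorem openCell_nonempty {T : Finset (E d)} (hT : AffineIndependent ℝ ((↑) : T → E d))
    (hc : T.card = d + 1) : (openCell T).Nonempty := by
  rw [openCell, hull, interior_convexHull_nonempty_iff_affineSpan_eq_top]
  simpa using affineSpan_eq_top hT hc

theorem closure_openCell {T : Finset (E d)} (hT : AffineIndependent ℝ ((↑) : T → E d))
    (hc : T.card = d + 1) : closure (openCell T) = hull T := by
  rw [openCell, (convex_hull T).closure_interior_eq_closure_of_nonempty_interior
    (openCell_nonempty hT hc), (isCompact_hull T).isClosed.closure_eq]

/-- The height of a vertex over the opposite side, with the unit normal of that side. -/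
theorem exists_unit_height {T e : Finset (E d)} {a : E d}
    (hT : AffineIndependent ℝ ((↑) : T → E d)) (hc : T.card = d + 1) (ha : a ∈ T) (hae : a ∉ e)
    (he : e ⊆ T) (hne : e.Nonempty) :
    ∃ ν : E d, ‖ν‖ = 1 ∧ ∃ H : ℝ, 0 < H ∧ ∀ x ∈ e, inner ℝ ν (x - a) = H := by
  let B : AffineBasis T ℝ (E d) := ⟨(↑), hT, affineSpan_eq_top hT hc⟩
  -- The barycentric coordinate of `a` is 1 at `a` and 0 on `e`. Its negative gradient `w` is
  -- therefore normal to `e`, and the height is $1/\|w\|$.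
  let φ : E d →L[ℝ] ℝ := (B.coord ⟨a, ha⟩).linear.toContinuousLinearMap
  let w : E d := (InnerProductSpace.toDual ℝ (E d)).symm (-φ)
  have hw : ∀ x ∈ e, inner ℝ w (x - a) = 1 := fun x hx => by
    have h₁ : φ (x - a) = B.coord ⟨a, ha⟩ (B ⟨x, he hx⟩) - B.coord ⟨a, ha⟩ (B ⟨a, ha⟩) :=
      (B.coord ⟨a, ha⟩).linearMap_vsub x a
    have h₂ : (⟨a, ha⟩ : T) ≠ ⟨x, he hx⟩ := fun h => by
      have h' : a = x := congrArg Subtype.val h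
      exact hae (by rwa [h'])
    rw [B.coord_apply_ne h₂, B.coord_apply_eq] at h₁
    simp [w, h₁]
  obtain ⟨x₀, hx₀⟩ := hne
  have hw0 : 0 < ‖w‖ := norm_pos_iff.2 fun h => by simpa [h] using hw x₀ hx₀
  refine ⟨‖w‖⁻¹ • w, by rw [norm_smul, norm_inv, norm_norm, inv_mul_cancel₀ hw0.ne'], ‖w‖⁻¹,
    inv_pos.2 hw0, fun x hx => ?_⟩
  rw [real_inner_smul_left, hw x hx, mul_one]

/-- Checking heights at the vertices suffices; this is used with $\{H\}$ on the side and $[0,H]$ on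
the simplex. -/
theorem inner_sub_mem_of_mem_hull {s : Finset (E d)} {ν a x : E d} {C : Set ℝ} (hC : Convex ℝ C)
    (h : ∀ y ∈ s, inner ℝ ν (y - a) ∈ C) (hx : x ∈ hull s) : inner ℝ ν (x - a) ∈ C := by
  have hconv : Convex ℝ ((fun y : E d => (innerSL ℝ ν) (y + -a)) ⁻¹' C) :=
    (hC.linear_preimage (innerSL ℝ ν).toLinearMap).translate_preimage_left (-a)
  have := convexHull_min (s := (s : Set (E d))) (fun y hy => by
    simpa [sub_eq_add_neg] using h y hy) hconv hx
  simpa [sub_eq_add_neg] using this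

theorem exists_orthonormalBasis_zero_eq {ν : E (m + 1)} (hν : ‖ν‖ = 1) :
    ∃ b : OrthonormalBasis (Fin (m + 1)) ℝ (E (m + 1)), b 0 = ν := by
  have hv : Orthonormal ℝ (({0} : Set (Fin (m + 1))).domRestrict fun _ => ν) := by
    refine ⟨fun _ => hν, fun i j hij => absurd (Subsingleton.elim i j) hij⟩
  obtain ⟨b, hb⟩ := hv.exists_orthonormalBasis_extension_of_card_eq (by simp)
  exact ⟨b, hb 0 rfl⟩

/-- The trace inequality on the side `e` of the simplex `T`, with the height `H` of `T` over `e`. -/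
theorem exists_trace_inequality {T e : Finset (E (m + 1))}
    (hT : AffineIndependent ℝ ((↑) : T → E (m + 1))) (hc : T.card = m + 2) (he : e ⊆ T)
    (hec : e.card = m + 1) :
    Measure.euclideanHausdorffMeasure m (hull e) ≠ ⊤ ∧
    ∃ H : ℝ, 0 < H ∧ (∀ c r, 0 < r → Metric.ball c r ⊆ hull T → 2 * r ≤ H) ∧
      ∀ G : E (m + 1) → ℝ, ContDiff ℝ 1 G →
        H * (∫ x in hull e, G x ^ 2 ∂(Measure.euclideanHausdorffMeasure m))
          ≤ ∫ x in hull T, ((m + 2) * G x ^ 2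
            + size T ^ 2 * ∑ k, fderiv ℝ G x (EuclideanSpace.single k 1) ^ 2) := by
  obtain ⟨a, haT, hae⟩ : ∃ a ∈ T, a ∉ e :=
    Finset.exists_mem_notMem_of_card_lt_card (by omega)
  have hins : ∀ x ∈ T, x = a ∨ x ∈ e := by
    classical
    have : insert a e = T := Finset.eq_of_subset_of_card_le
      (Finset.insert_subset haT he) (by rw [Finset.card_insert_of_notMem hae]; omega)
    intro x hx
    rwa [← this, Finset.mem_insert] at hx
  obtain ⟨ν, hν, H, hH, hHe⟩ := exists_unit_height hT hc haT hae he
    (Finset.card_pos.1 (by omega))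
  obtain ⟨b, rfl⟩ := exists_orthonormalBasis_zero_eq hν
  have hslice : ∀ x ∈ hull e, inner ℝ (b 0) (x - a) = H := fun x hx =>
    inner_sub_mem_of_mem_hull (C := {H}) (convex_singleton H) hHe hx
  have hmem : ∀ x ∈ hull T, inner ℝ (b 0) (x - a) ∈ Icc 0 H := fun x hx =>
    inner_sub_mem_of_mem_hull (convex_Icc 0 H) (fun y hy => by
      rcases hins y hy with rfl | hy
      · simp [hH.le]
      · rw [hHe y hy]; exact ⟨hH.le, le_rfl⟩) hx
  have hme := (isCompact_hull e).measurableSet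
  have hi := isometry_coords b a H
  have hA : IsCompact ((fun y => coords b a (H, y)) ⁻¹' hull e) :=
    hi.isClosedEmbedding.isCompact_preimage (isCompact_hull e)
  have hfin : Measure.euclideanHausdorffMeasure m (hull e) ≠ ⊤ := by
    have := lintegral_slice b a hme hslice (f := fun _ => 1) measurable_const
    simp only [lintegral_one, Measure.restrict_apply_univ] at this
    rw [this]
    exact hA.measure_ne_top
  have haT' : a ∈ hull T := subset_hull T haT
  refine ⟨hfin, H, hH, fun c r hr hball => ?_, fun G hG => ?_⟩
  -- For $0<s<2r$ the points $c\pm\frac s2 b_0$ lie in the ball, so their heights, which differ by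
  -- $s$, both lie in $[0,H]$.
  · refine le_of_forall_lt_imp_le_of_dense fun s hs => ?_
    rcases le_or_gt s 0 with h0 | h0
    · linarith
    have hm : ∀ t : ℝ, |t| < r → inner ℝ (b 0) (c - a) + t ∈ Icc 0 H := fun t ht => by
      have h := hmem (c + t • b 0) (hball (by simpa [norm_smul] using ht))
      rwa [add_sub_right_comm, inner_add_right, real_inner_smul_right,
        real_inner_self_eq_norm_sq, hν, one_pow, mul_one] at h
    have h₁ := (hm (s / 2) (by rw [abs_of_pos (by linarith)]; linarith)).2
    have h₂ := (hm (-(s / 2)) (by rw [abs_neg, abs_of_pos (by linarith)]; linarith)).1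
    linarith
  · have hG' : Continuous (fderiv ℝ G) := hG.continuous_fderiv (by norm_num)
    have hGc := hG.continuous
    have key := lintegral_base_sq_le b a hA.measurableSet (isCompact_hull T).measurableSet hH
      (D := size T) (fun y hy t ht => ?_) (fun y hy => ?_) hG
    · rw [← lintegral_slice b a hme hslice (f := fun x => ENNReal.ofReal (G x ^ 2))
        (by fun_prop), ← ofReal_integral_eq_lintegral_ofReal, ← ofReal_integral_eq_lintegral_ofReal,
        ← ENNReal.ofReal_mul hH.le, ENNReal.ofReal_le_ofReal_iff] at key
      · exact key
      · exact integral_nonneg fun x => by positivity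
      · exact ContinuousOn.integrableOn_compact (isCompact_hull T) (by fun_prop)
      · exact ae_of_all _ fun x => by positivity
      · exact ContinuousOn.integrableOn_of_subset_isCompact (by fun_prop) (isCompact_hull e) hme
          Subset.rfl hfin
      · exact ae_of_all _ fun x => by positivity
    · rw [coords_smul]
      exact (convex_hull T).add_smul_sub_mem haT' (hull_mono he hy) ⟨ht.1.le, ht.2⟩
    · rw [← dist_eq_norm]
      exact Metric.dist_le_diam_of_mem (isCompact_hull T).isBounded (hull_mono he hy) haT'

end Simplex

/-! ### Smooth fields on a simplex -/

theorem abs_integral_le_young {α : Type*} [MeasurableSpace α] {μ : Measure α} {f g h : α → ℝ}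
    {θ : ℝ} (hg : Integrable g μ) (hh : Integrable h μ) (H : ∀ x, |f x| ≤ θ * g x + θ⁻¹ * h x) :
    |∫ x, f x ∂μ| ≤ θ * (∫ x, g x ∂μ) + θ⁻¹ * ∫ x, h x ∂μ := by
  have e := integral_add (hg.const_mul θ) (hh.const_mul θ⁻¹)
  rw [integral_const_mul, integral_const_mul] at e
  rw [← e]
  rw [← Real.norm_eq_abs]
  exact norm_integral_le_of_norm_le (f := f) ((hg.const_mul θ).add (hh.const_mul θ⁻¹))
    (ae_of_all _ H)

theorem integral_sum_sum {α ι κ : Type*} [MeasurableSpace α] {μ : Measure α} [Fintype ι] [Fintype κ]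
    {f : ι → κ → α → ℝ} (hf : ∀ i j, Integrable (f i j) μ) :
    ∫ x, ∑ i, ∑ j, f i j x ∂μ = ∑ i, ∑ j, ∫ x, f i j x ∂μ := by
  rw [integral_finsetSum _ fun i _ => integrable_finsetSum _ fun j _ => hf i j]
  exact Finset.sum_congr rfl fun i _ => integral_finsetSum _ fun j _ => hf i j

section Cell

variable {d : ℕ} {T : Finset (E d)} {u P : E d → E d}

theorem grad_congr (h : EqOn u P (openCell T)) : EqOn (grad u) (grad P) (openCell T) := by
  intro x hx
  have : u =ᶠ[𝓝 x] P := Filter.eventuallyEq_of_mem (isOpen_interior.mem_nhds hx) h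
  ext i j
  simp only [grad, this.fderiv_eq]

theorem sgrad_congr (h : EqOn u P (openCell T)) : EqOn (sgrad u) (sgrad P) (openCell T) :=
  fun x hx => by simp only [sgrad, grad_congr h hx]

theorem div_congr (h : EqOn u P (openCell T)) : EqOn (div u) (div P) (openCell T) :=
  fun x hx => by simp only [div, grad_congr h hx]

theorem second_congr (h : EqOn u P (openCell T)) (i j k : Fin d) :
    EqOn (second u i j k) (second P i j k) (openCell T) := by
  intro x hx
  have : (fun y => grad u y i j) =ᶠ[𝓝 x] fun y => grad P y i j :=
    Filter.eventuallyEq_of_mem (isOpen_interior.mem_nhds hx) fun y hy => by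
      simp only [grad_congr h hy]
  simp only [second, this.fderiv_eq]

theorem contDiff_grad (hP : ContDiff ℝ ∞ P) (i j : Fin d) :
    ContDiff ℝ ∞ fun x => grad P x i j := by
  have h : ContDiff ℝ ∞ fun x => fderiv ℝ P x (EuclideanSpace.single j 1) :=
    (hP.fderiv_right (m := ∞) (by simp)).clm_apply contDiff_const
  exact (contDiff_euclidean.1 h) i

theorem continuous_grad (hP : ContDiff ℝ ∞ P) : Continuous (grad P) :=
  continuous_matrix fun i j => (contDiff_grad hP i j).continuous

theorem continuous_sgrad (hP : ContDiff ℝ ∞ P) : Continuous (sgrad P) :=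
  ((continuous_grad hP).add (continuous_grad hP).matrix_transpose).const_smul (1 / 2 : ℝ)

theorem continuous_div (hP : ContDiff ℝ ∞ P) : Continuous (div P) :=
  (continuous_grad hP).matrix_trace

theorem continuous_second (hP : ContDiff ℝ ∞ P) (i j k : Fin d) : Continuous (second P i j k) :=
  ((contDiff_grad hP i j).continuous_fderiv (by simp)).clm_apply continuous_const

/-- Needed because the DG norm counts each mixed derivative only once, while the trace inequality
produces all ordered pairs. -/
theorem second_symm (hP : ContDiff ℝ ∞ P) (i j k : Fin d) : second P i j k = second P i k j := by
  ext x
  have h : ∀ j k, second P i j k x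
      = (fderiv ℝ (fderiv ℝ P) x (EuclideanSpace.single k 1) (EuclideanSpace.single j 1)) i := by
    intro j k
    have hd : DifferentiableAt ℝ (fderiv ℝ P) x :=
      (hP.fderiv_right (m := ∞) (by simp)).differentiable (by simp) x
    have h₁ := (hd.hasFDerivAt.clm_apply (hasFDerivAt_const (EuclideanSpace.single j (1 : ℝ)) x))
    have h₂ := ((EuclideanSpace.proj i : E d →L[ℝ] ℝ).hasFDerivAt.comp x h₁).fderiv
    simp only [second]
    change fderiv ℝ ((EuclideanSpace.proj i : E d →L[ℝ] ℝ) ∘ fun y =>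
      fderiv ℝ P y (EuclideanSpace.single j 1)) x _ = _
    rw [h₂]
    simp
  rw [h, h]
  have hs : IsSymmSndFDerivAt ℝ P x :=
    hP.contDiffAt.isSymmSndFDerivAt (by
      rw [minSmoothness_of_isRCLikeNormedField]
      exact WithTop.coe_le_coe.2 le_top)
  rw [hs.eq]

theorem frob_self_nonneg (A : Matrix (Fin d) (Fin d) ℝ) : 0 ≤ frob A A :=
  Finset.sum_nonneg fun _ _ => Finset.sum_nonneg fun _ _ => mul_self_nonneg _

theorem continuous_frob {f g : E d → Matrix (Fin d) (Fin d) ℝ} (hf : Continuous f)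
    (hg : Continuous g) : Continuous fun x => frob (f x) (g x) :=
  continuous_finsetSum _ fun _ _ => continuous_finsetSum _ fun _ _ =>
    (hf.matrix_elem _ _).mul (hg.matrix_elem _ _)

theorem abs_frob_le_young (A B : Matrix (Fin d) (Fin d) ℝ) {θ : ℝ} (hθ : 0 < θ) :
    |frob A B| ≤ θ * frob A A + θ⁻¹ * frob B B := by
  simp only [frob, Finset.mul_sum, ← Finset.sum_add_distrib]
  refine (Finset.abs_sum_le_sum_abs _ _).trans (Finset.sum_le_sum fun i _ =>
    (Finset.abs_sum_le_sum_abs _ _).trans (Finset.sum_le_sum fun j _ => ?_))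
  simpa [sq] using abs_mul_le_young (A i j) (B i j) hθ

theorem frob_sgrad_le (u : E d → E d) (x : E d) :
    frob (sgrad u x) (sgrad u x) ≤ frob (grad u x) (grad u x) := by
  set A := grad u x
  have h : frob (sgrad u x) (sgrad u x)
      ≤ ∑ i, ∑ j, (1 / 2 * (A i j * A i j) + 1 / 2 * (A j i * A j i)) := by
    refine Finset.sum_le_sum fun i _ => Finset.sum_le_sum fun j _ => ?_
    simp only [sgrad, Matrix.smul_apply, Matrix.add_apply, Matrix.transpose_apply, smul_eq_mul]
    nlinarith [sq_nonneg (A i j - A j i)]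
  refine h.trans (le_of_eq ?_)
  simp only [Finset.sum_add_distrib, frob]
  rw [Finset.sum_comm (f := fun i j => 1 / 2 * (A j i * A j i))]
  simp only [← Finset.mul_sum]
  ring

theorem norm_app_sq_le (A : Matrix (Fin d) (Fin d) ℝ) {ν : E d} (hν : ‖ν‖ ≤ 1) :
    ‖app A ν‖ ^ 2 ≤ frob A A := by
  rw [EuclideanSpace.real_norm_sq_eq]
  refine Finset.sum_le_sum fun i _ => ?_
  have h := Finset.sum_mul_sq_le_sq_mul_sq Finset.univ (A i) ν.ofLp
  have h₂ : ∑ j, ν.ofLp j ^ 2 ≤ 1 := by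
    rw [← EuclideanSpace.real_norm_sq_eq]
    exact pow_le_one₀ (norm_nonneg _) hν
  have h₃ : 0 ≤ ∑ j, A i j ^ 2 := Finset.sum_nonneg fun j _ => sq_nonneg _
  calc (app A ν) i ^ 2 = (∑ j, A i j * ν.ofLp j) ^ 2 := rfl
    _ ≤ (∑ j, A i j ^ 2) * ∑ j, ν.ofLp j ^ 2 := h
    _ ≤ ∑ j, A i j ^ 2 := mul_le_of_le_one_right h₃ h₂
    _ = _ := by simp only [sq]

theorem norm_outerNormal_le (T e : Finset (E d)) : ‖outerNormal T e‖ ≤ 1 := by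
  unfold outerNormal
  split_ifs with h
  · exact h.choose_spec.1.le
  · simp

/-- The open cell is dense in the closed simplex, so the limit from inside is the value of the
continuous representative, also on the sides. -/
theorem trace_eq {F : Type*} [TopologicalSpace F] [T2Space F] {f g : E d → F}
    (hT : AffineIndependent ℝ ((↑) : T → E d)) (hc : T.card = d + 1)
    (h : EqOn f g (openCell T)) (hg : Continuous g) : EqOn (trace T f) g (hull T) := by
  intro x hx
  refine extendFrom_eq (by rwa [closure_openCell hT hc]) ?_
  refine (hg.continuousWithinAt (s := openCell T) (x := x)).tendsto.congr' ?_
  filter_upwards [self_mem_nhdsWithin] with y hy using (h hy).symm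

theorem openCell_ae_eq_hull (T : Finset (E d)) : openCell T =ᵐ[volume] hull T :=
  interior_ae_eq_of_null_frontier ((convex_hull T).addHaar_frontier volume)

theorem integrableOn_openCell {F : Type*} [NormedAddCommGroup F] {f g : E d → F} (hg : Continuous g)
    (h : EqOn f g (openCell T)) : IntegrableOn f (openCell T) := by
  have : IntegrableOn g (openCell T) :=
    (hg.continuousOn.integrableOn_compact (isCompact_hull T)).mono_set interior_subset
  exact this.congr_fun h.symm isOpen_interior.measurableSet

/-- The part of the DG norm that belongs to the element `T`, with all second derivatives. -/
noncomputable def cellSq (T : Finset (E d)) (u : E d → E d) : ℝ :=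
  (d + 1) * (∫ x in openCell T, frob (grad u x) (grad u x))
    + size T ^ 2 * ∑ i, ∑ j, ∑ k, ∫ x in openCell T, second u i j k x ^ 2

/-- By symmetry the pairs $k\ge j$ contribute as much as the pairs $k\le j$; the diagonal is counted
twice. -/
theorem sum_second_le (hP : ContDiff ℝ ∞ P) (h : EqOn u P (openCell T)) :
    ∑ i, ∑ j, ∑ k, ∫ x in openCell T, second u i j k x ^ 2
      ≤ 2 * ∑ i, ∑ j, ∑ k ∈ Finset.Iic j, ∫ x in openCell T, second u i j k x ^ 2 := by
  rw [Finset.mul_sum]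
  refine Finset.sum_le_sum fun i _ => ?_
  set s : Fin d → Fin d → ℝ := fun j k => ∫ x in openCell T, second u i j k x ^ 2 with hs
  have hsym : ∀ j k, s j k = s k j := fun j k =>
    setIntegral_congr_fun isOpen_interior.measurableSet fun x hx => by
      simp only [second_congr h i _ _ hx, second_symm hP i j k]
  have hnn : ∀ j k, 0 ≤ s j k := fun j k => integral_nonneg fun x => sq_nonneg _
  have h₁ : ∀ j, ∑ k, s j k ≤ ∑ k ∈ Finset.Iic j, s j k + ∑ k ∈ Finset.Ici j, s j k := fun j => by
    rw [← Finset.sum_union_inter]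
    have : Finset.Iic j ∪ Finset.Ici j = Finset.univ := by
      ext k; simpa using le_total k j
    rw [this]
    have := Finset.sum_nonneg fun k (_ : k ∈ Finset.Iic j ∩ Finset.Ici j) => hnn j k
    linarith
  have h₂ : ∑ j, ∑ k ∈ Finset.Ici j, s j k = ∑ j, ∑ k ∈ Finset.Iic j, s j k := by
    rw [Finset.sum_comm' (t' := Finset.univ) (s' := fun k => Finset.Iic k) (by simp)]
    exact Finset.sum_congr rfl fun j _ => Finset.sum_congr rfl fun k _ => hsym k j
  calc ∑ j, ∑ k, s j k ≤ ∑ j, (∑ k ∈ Finset.Iic j, s j k + ∑ k ∈ Finset.Ici j, s j k) :=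
        Finset.sum_le_sum fun j _ => h₁ j
    _ = 2 * ∑ j, ∑ k ∈ Finset.Iic j, s j k := by
        rw [Finset.sum_add_distrib, h₂, two_mul]

theorem euclideanHausdorffMeasure_side_ne_top (hd : 1 ≤ d) {e : Finset (E d)} (hT : AffineIndependent ℝ ((↑) : T → E d))
    (hc : T.card = d + 1) (he : e ⊆ T) (hec : e.card = d) :
    Measure.euclideanHausdorffMeasure (d - 1) (hull e) ≠ ⊤ := by
  obtain ⟨m, rfl⟩ : ∃ m, d = m + 1 := ⟨d - 1, by omega⟩
  exact (exists_trace_inequality hT hc he hec).1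

theorem size_mul_sideIntegral_sgrad_le (hd : 1 ≤ d) {e : Finset (E d)}
    (hT : AffineIndependent ℝ ((↑) : T → E d)) (hc : T.card = d + 1) (he : e ⊆ T)
    (hec : e.card = d) {σ : ℝ} {c : E d} {r : ℝ} (hr : 0 < r) (hball : Metric.ball c r ⊆ hull T)
    (hσ : size T ≤ σ * (2 * r)) (hP : ContDiff ℝ ∞ P) (h : EqOn u P (openCell T)) :
    size e * sideIntegral e (fun x => frob (sgrad P x) (sgrad P x)) ≤ |σ| * cellSq T u := by
  have hcell : cellSq T u = cellSq T P := by
    unfold cellSq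
    congr 2
    · exact setIntegral_congr_fun isOpen_interior.measurableSet fun x hx => by
        simp only [grad_congr h hx]
    · refine Finset.sum_congr rfl fun i _ => Finset.sum_congr rfl fun j _ =>
        Finset.sum_congr rfl fun k _ => ?_
      exact setIntegral_congr_fun isOpen_interior.measurableSet fun x hx => by
        simp only [second_congr h i j k hx]
  have hfin := euclideanHausdorffMeasure_side_ne_top hd hT hc he hec
  rw [hcell]
  clear hcell h
  obtain ⟨m, rfl⟩ : ∃ m, d = m + 1 := ⟨d - 1, by omega⟩
  obtain ⟨-, H, hH, hHr, hG⟩ := exists_trace_inequality hT hc he hec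
  have hint : ∀ f : E (m + 1) → ℝ, Continuous f →
      IntegrableOn f (hull e) (Measure.euclideanHausdorffMeasure m) := fun f hf =>
    hf.continuousOn.integrableOn_of_subset_isCompact (isCompact_hull e)
      (isCompact_hull e).measurableSet Subset.rfl hfin
  have hintT : ∀ f : E (m + 1) → ℝ, Continuous f → IntegrableOn f (hull T) := fun f hf =>
    hf.continuousOn.integrableOn_compact (isCompact_hull T)
  have hg : ∀ i j, Continuous fun x => grad P x i j := fun i j => (contDiff_grad hP i j).continuous
  have hs := continuous_second hP
  set I := sideIntegral e (fun x => frob (sgrad P x) (sgrad P x)) with hI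
  have hI0 : 0 ≤ I := integral_nonneg fun x => frob_self_nonneg _
  have hIle : H * I ≤ cellSq T P := by
    have e₁ : I ≤ ∑ i, ∑ j, ∫ x in hull e, grad P x i j ^ 2
        ∂(Measure.euclideanHausdorffMeasure m) := by
      rw [← integral_sum_sum fun i j => hint (fun x => grad P x i j ^ 2) ((hg i j).pow 2)]
      refine integral_mono (hint _ (continuous_frob (continuous_sgrad hP) (continuous_sgrad hP)))
        (hint _ (by fun_prop)) fun x => ?_
      simpa only [frob, sq] using frob_sgrad_le P x
    have e₂ : ∀ i j, H * ∫ x in hull e, grad P x i j ^ 2 ∂(Measure.euclideanHausdorffMeasure m)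
        ≤ (m + 2) * (∫ x in openCell T, grad P x i j ^ 2)
          + size T ^ 2 * ∑ k, ∫ x in openCell T, second P i j k x ^ 2 := fun i j => by
      refine (hG _ ((contDiff_grad hP i j).of_le (by simp))).trans (le_of_eq ?_)
      change ∫ x in hull T, ((m + 2) * grad P x i j ^ 2
        + size T ^ 2 * ∑ k, second P i j k x ^ 2) = _
      rw [integral_add (hintT _ (by fun_prop)) (hintT _ (by fun_prop)), integral_const_mul,
        integral_const_mul, integral_finsetSum _ fun k _ => hintT _ (by fun_prop)]
      simp only [setIntegral_congr_set (openCell_ae_eq_hull T)]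
    have e₃ : ∫ x in openCell T, frob (grad P x) (grad P x)
        = ∑ i, ∑ j, ∫ x in openCell T, grad P x i j ^ 2 := by
      have hi : ∀ f : E (m + 1) → ℝ, Continuous f → IntegrableOn f (openCell T) := fun f hf =>
        integrableOn_openCell hf (eqOn_refl _ _)
      rw [← integral_sum_sum fun i j => hi (fun x => grad P x i j ^ 2) ((hg i j).pow 2)]
      simp only [frob, sq]
    calc H * I ≤ H * ∑ i, ∑ j, ∫ x in hull e, grad P x i j ^ 2
        ∂(Measure.euclideanHausdorffMeasure m) := by gcongr
      _ ≤ ∑ i, ∑ j, ((m + 2) * (∫ x in openCell T, grad P x i j ^ 2)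
          + size T ^ 2 * ∑ k, ∫ x in openCell T, second P i j k x ^ 2) := by
        simp only [Finset.mul_sum (a := H)]
        exact Finset.sum_le_sum fun i _ => Finset.sum_le_sum fun j _ => e₂ i j
      _ = _ := by
        -- With $d=m+1$ the factor $m+2$ is the $d+1$ of `cellSq`.
        simp only [Finset.sum_add_distrib, ← Finset.mul_sum, cellSq, e₃]
        push_cast
        ring
  -- Shape regularity enters here: $h_e\le h_T\le\sigma\cdot2r\le|\sigma|H$.
  have hsize : size e ≤ |σ| * H := by
    refine (size_mono he).trans (hσ.trans ?_)
    have := hHr c r hr hball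
    calc σ * (2 * r) ≤ |σ| * (2 * r) := by gcongr; exact le_abs_self σ
      _ ≤ |σ| * H := by gcongr
  calc size e * I ≤ |σ| * H * I := by gcongr
    _ = |σ| * (H * I) := by ring
    _ ≤ _ := by gcongr

end Cell

/-! ### The bilinear form `a_h` -/

namespace Triangulation

variable {d : ℕ} {Ω : Set (E d)} {M : Triangulation d Ω} {T e : Finset (E d)}

theorem mem_cells : T ∈ M.cells ↔ T ∈ M.complex.faces ∧ T.card = d + 1 := by
  simp [cells]

theorem mem_sides : e ∈ M.sides ↔ e ∈ M.complex.faces ∧ e.card = d := by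
  simp [sides]

theorem indep_of_mem_cells (hT : T ∈ M.cells) : AffineIndependent ℝ ((↑) : T → E d) :=
  M.complex.indep (mem_cells.1 hT).1

theorem cell₁_spec (he : e ∈ M.sides) : M.cell₁ e ∈ M.cells ∧ e ⊆ M.cell₁ e := by
  have h : ∃ T ∈ M.cells, e ⊆ T := by
    obtain ⟨T, hT, heT, hc⟩ := M.pure e (mem_sides.1 he).1
    exact ⟨T, mem_cells.2 ⟨hT, hc⟩, heT⟩
  rw [cell₁, dif_pos h]
  exact h.choose_spec

theorem cell₂_spec (he : M.IsInteriorSide e) : M.cell₂ e ∈ M.cells ∧ e ⊆ M.cell₂ e := by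
  rw [cell₂, dif_pos he]
  exact ⟨he.choose_spec.1, he.choose_spec.2.1⟩

open Classical in
theorem card_sides_filter_le (hT : T ∈ M.cells) : (M.sides.filter (· ⊆ T)).card ≤ d + 1 := by
  have h : M.sides.filter (· ⊆ T) ⊆ T.powersetCard d := fun e he => by
    rw [Finset.mem_filter, mem_sides] at he
    exact Finset.mem_powersetCard.2 ⟨he.2, he.1.2⟩
  refine (Finset.card_le_card h).trans ?_
  rw [Finset.card_powersetCard, (mem_cells.1 hT).2, Nat.choose_succ_self_right]

theorem subset_iUnion_hull (M : Triangulation d Ω) : Ω ⊆ ⋃ T ∈ M.cells, hull T := by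
  intro x hx
  rw [← M.interior_space] at hx
  obtain ⟨s, hs, hxs⟩ := Geometry.SimplicialComplex.mem_space_iff.1 (interior_subset hx)
  obtain ⟨T, hT, hsT, hc⟩ := M.pure s hs
  exact mem_biUnion (mem_cells.2 ⟨hT, hc⟩) (hull_mono hsT hxs)

/-- The fields `P T`, for the elements `T`, are smooth, and `u` agrees with `P T` on `T`. -/
def IsSmoothRep (M : Triangulation d Ω) (u : E d → E d) (P : Finset (E d) → E d → E d) : Prop :=
  ∀ T ∈ M.cells, ContDiff ℝ ∞ (P T) ∧ EqOn u (P T) (openCell T)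

end Triangulation

open Triangulation

/-! ### Jumps, averages and the bound for $a_h$. -/

section Side

variable {d : ℕ} {Ω : Set (E d)} {M : Triangulation d Ω} {e : Finset (E d)}
  {u w : E d → E d} {P R : Finset (E d) → E d → E d}

theorem integrableOn_side (hd : 1 ≤ d) (he : e ∈ M.sides) {f : E d → ℝ} (hf : Continuous f) :
    IntegrableOn f (hull e) (Measure.euclideanHausdorffMeasure (d - 1)) := by
  obtain ⟨h₁, h₂⟩ := cell₁_spec he
  exact hf.continuousOn.integrableOn_of_subset_isCompact (isCompact_hull e)
    (isCompact_hull e).measurableSet Subset.rfl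
    (euclideanHausdorffMeasure_side_ne_top hd (indep_of_mem_cells h₁) (mem_cells.1 h₁).2 h₂ (mem_sides.1 he).2)

theorem sideIntegral_congr {f g : E d → ℝ} (h : EqOn f g (hull e)) :
    sideIntegral e f = sideIntegral e g :=
  setIntegral_congr_fun (isCompact_hull e).measurableSet h

/-- Replacing the traces by continuous functions makes every side integrand integrable. -/
theorem exists_continuous_jumpT (he : e ∈ M.sides) (hP : M.IsSmoothRep u P) :
    ∃ J : E d → E d, Continuous J ∧ EqOn (jumpT M e u) J (hull e) := by
  have key : ∀ T ∈ M.cells, e ⊆ T → ∀ ν, Continuous (fun x => tangential ν (P T x)) ∧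
      EqOn (fun x => tangential ν (trace T u x)) (fun x => tangential ν (P T x)) (hull e) := by
    intro T hT heT ν
    have hc := (hP T hT).1.continuous
    refine ⟨by unfold tangential; fun_prop, fun x hx => ?_⟩
    simp only [trace_eq (indep_of_mem_cells hT) (mem_cells.1 hT).2 (hP T hT).2 hc
      (hull_mono heT hx)]
  obtain ⟨h₁, h₂⟩ := cell₁_spec he
  unfold jumpT
  by_cases hi : M.IsInteriorSide e
  · obtain ⟨h₃, h₄⟩ := cell₂_spec hi
    simp only [if_pos hi]
    exact ⟨_, (key _ h₁ h₂ _).1.sub (key _ h₃ h₄ _).1, fun x hx =>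
      congrArg₂ (· - ·) ((key _ h₁ h₂ _).2 hx) ((key _ h₃ h₄ _).2 hx)⟩
  · simp only [if_neg hi]
    exact ⟨_, key _ h₁ h₂ _⟩

open Classical in
theorem exists_continuous_avg (he : e ∈ M.sides) (hP : M.IsSmoothRep u P) :
    ∃ J : E d → E d, Continuous J ∧ EqOn (avg M e (sgrad u)) J (hull e) ∧
      ∀ x, ‖J x‖ ^ 2 ≤ ∑ T ∈ M.cells with e ⊆ T, frob (sgrad (P T) x) (sgrad (P T) x) := by
  have key : ∀ T ∈ M.cells, e ⊆ T → ∀ ν : E d, ‖ν‖ ≤ 1 →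
      Continuous (fun x => app (sgrad (P T) x) ν) ∧
      EqOn (fun x => app (trace T (sgrad u) x) ν) (fun x => app (sgrad (P T) x) ν) (hull e) ∧
      ∀ x, ‖app (sgrad (P T) x) ν‖ ^ 2
        ≤ ∑ T ∈ M.cells with e ⊆ T, frob (sgrad (P T) x) (sgrad (P T) x) := by
    intro T hT heT ν hν
    have hc := continuous_sgrad (hP T hT).1
    refine ⟨(PiLp.continuous_toLp 2 _).comp (hc.matrix_mulVec continuous_const),
      fun x hx => ?_, fun x => ?_⟩
    · simp only [trace_eq (indep_of_mem_cells hT) (mem_cells.1 hT).2 (sgrad_congr (hP T hT).2) hc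
        (hull_mono heT hx)]
    · refine (norm_app_sq_le _ hν).trans ?_
      exact Finset.single_le_sum (f := fun T => frob (sgrad (P T) x) (sgrad (P T) x))
        (fun _ _ => frob_self_nonneg _) (Finset.mem_filter.2 ⟨hT, heT⟩)
  obtain ⟨h₁, h₂⟩ := cell₁_spec he
  unfold avg
  have k₁ := key _ h₁ h₂ _ (norm_outerNormal_le (M.cell₁ e) e)
  by_cases hi : M.IsInteriorSide e
  · obtain ⟨h₃, h₄⟩ := cell₂_spec hi
    have k₂ := key _ h₃ h₄ _ (norm_outerNormal_le (M.cell₂ e) e)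
    simp only [if_pos hi]
    refine ⟨_, (k₁.1.sub k₂.1).const_smul (1 / 2 : ℝ), fun x hx => ?_, fun x => ?_⟩
    · have e₁ := k₁.2.1 hx
      have e₂ := k₂.2.1 hx
      simp only at e₁ e₂
      simp only [e₁, e₂, Pi.smul_apply, Pi.sub_apply]
    · have b₁ := k₁.2.2 x
      have b₂ := k₂.2.2 x
      simp only [Pi.smul_apply, Pi.sub_apply, norm_smul, mul_pow]
      set p := app (sgrad (P (M.cell₁ e)) x) (outerNormal (M.cell₁ e) e)
      set q := app (sgrad (P (M.cell₂ e)) x) (outerNormal (M.cell₂ e) e)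
      -- It gives $\frac14\|p-q\|^2\le\frac12(\|p\|^2+\|q\|^2)$, and each of the two squares is at
      -- most the whole sum over the elements containing `e`.
      have h := parallelogram_law_with_norm ℝ p q
      have : ‖(1 / 2 : ℝ)‖ ^ 2 = 1 / 4 := by norm_num
      rw [this]
      nlinarith [sq_nonneg ‖p + q‖]
  · simp only [if_neg hi]
    exact ⟨_, k₁⟩

theorem cellSq_nonneg (T : Finset (E d)) (u : E d → E d) : 0 ≤ cellSq T u := by
  have h₁ : 0 ≤ ∫ x in openCell T, frob (grad u x) (grad u x) :=
    integral_nonneg fun x => frob_self_nonneg _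
  have h₂ : 0 ≤ ∑ i, ∑ j, ∑ k, ∫ x in openCell T, second u i j k x ^ 2 :=
    Finset.sum_nonneg fun i _ => Finset.sum_nonneg fun j _ => Finset.sum_nonneg fun k _ =>
      integral_nonneg fun x => sq_nonneg _
  unfold cellSq
  positivity

/-- The sum of the averages of the stresses over the sides is bounded by the elements. -/
theorem sum_size_mul_avg_le (hd : 1 ≤ d) {σ : ℝ} (hσ : M.ShapeRegular σ) (hP : M.IsSmoothRep u P) :
    ∑ e ∈ M.sides, size e * sideIntegral e (fun x => ‖avg M e (sgrad u) x‖ ^ 2)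
      ≤ (d + 1) * |σ| * ∑ T ∈ M.cells, cellSq T u := by
  classical
  have h₁ : ∀ e ∈ M.sides, size e * sideIntegral e (fun x => ‖avg M e (sgrad u) x‖ ^ 2)
      ≤ ∑ T ∈ M.cells with e ⊆ T, |σ| * cellSq T u := by
    intro e he
    obtain ⟨J, hJ, hJe, hJb⟩ := exists_continuous_avg he hP
    have hT : ∀ T ∈ M.cells.filter (e ⊆ ·), T ∈ M.cells ∧ e ⊆ T := fun T h => Finset.mem_filter.1 h
    have hc : ∀ T ∈ M.cells.filter (e ⊆ ·),
        IntegrableOn (fun x => frob (sgrad (P T) x) (sgrad (P T) x)) (hull e)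
          (Measure.euclideanHausdorffMeasure (d - 1)) := fun T h =>
      integrableOn_side hd he (continuous_frob (continuous_sgrad (hP T (hT T h).1).1)
        (continuous_sgrad (hP T (hT T h).1).1))
    have h : sideIntegral e (fun x => ‖avg M e (sgrad u) x‖ ^ 2)
        ≤ ∑ T ∈ M.cells with e ⊆ T, sideIntegral e fun x => frob (sgrad (P T) x) (sgrad (P T) x) := by
      rw [sideIntegral_congr (g := fun x => ‖J x‖ ^ 2) fun x hx => by simp only [hJe hx]]
      unfold sideIntegral
      rw [← integral_finsetSum _ hc]
      exact integral_mono (integrableOn_side hd he (by fun_prop)) (integrable_finsetSum _ hc) hJb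
    refine (mul_le_mul_of_nonneg_left h (size_nonneg e)).trans ?_
    rw [Finset.mul_sum]
    refine Finset.sum_le_sum fun T h => ?_
    obtain ⟨hTc, heT⟩ := hT T h
    obtain ⟨c, r, hr, hball, hsz⟩ := hσ T hTc
    exact size_mul_sideIntegral_sgrad_le hd (indep_of_mem_cells hTc) (mem_cells.1 hTc).2 heT
      (mem_sides.1 he).2 hr hball hsz (hP T hTc).1 (hP T hTc).2
  refine (Finset.sum_le_sum h₁).trans ?_
  -- Summing over elements first, each element is met once for each of its at most $d+1$ sides.
  rw [Finset.sum_comm' (t' := M.cells) (s' := fun T => M.sides.filter (· ⊆ T)) (by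
    intro e T; simp only [Finset.mem_filter]; tauto), Finset.mul_sum]
  refine Finset.sum_le_sum fun T hT => ?_
  rw [Finset.sum_const, nsmul_eq_mul, ← mul_assoc]
  have : ((M.sides.filter (· ⊆ T)).card : ℝ) ≤ d + 1 := by
    exact_mod_cast card_sides_filter_le hT
  have := cellSq_nonneg T u
  gcongr

theorem dgSq_parts_nonneg (M : Triangulation d Ω) (u : E d → E d) :
    0 ≤ (∑ T ∈ M.cells, ∫ x in openCell T, frob (grad u x) (grad u x)) ∧
    0 ≤ (∑ e ∈ M.sides, (size e)⁻¹ * sideIntegral e (fun x => ‖jumpT M e u x‖ ^ 2)) ∧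
    0 ≤ (∑ T ∈ M.cells, size T ^ 2 *
        (∑ i, ∑ j, ∑ k ∈ Finset.Iic j, ∫ x in openCell T, second u i j k x ^ 2)) := by
  refine ⟨Finset.sum_nonneg fun T _ => integral_nonneg fun x => frob_self_nonneg _,
    Finset.sum_nonneg fun e _ => mul_nonneg (inv_nonneg.2 (size_nonneg e))
      (integral_nonneg fun x => sq_nonneg _),
    Finset.sum_nonneg fun T _ => mul_nonneg (sq_nonneg _) <|
      Finset.sum_nonneg fun i _ => Finset.sum_nonneg fun j _ => Finset.sum_nonneg fun k _ =>
        integral_nonneg fun x => sq_nonneg _⟩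

theorem dgSq_nonneg (M : Triangulation d Ω) (u : E d → E d) : 0 ≤ dgSq M u := by
  obtain ⟨h₁, h₂, h₃⟩ := dgSq_parts_nonneg M u
  unfold dgSq
  positivity

theorem sum_frob_le_dgSq (M : Triangulation d Ω) (u : E d → E d) :
    ∑ T ∈ M.cells, ∫ x in openCell T, frob (grad u x) (grad u x) ≤ dgSq M u := by
  obtain ⟨h₁, h₂, h₃⟩ := dgSq_parts_nonneg M u
  unfold dgSq
  linarith

theorem sum_jumpT_le_dgSq (M : Triangulation d Ω) (u : E d → E d) :
    ∑ e ∈ M.sides, (size e)⁻¹ * sideIntegral e (fun x => ‖jumpT M e u x‖ ^ 2) ≤ dgSq M u := by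
  obtain ⟨h₁, h₂, h₃⟩ := dgSq_parts_nonneg M u
  unfold dgSq
  linarith

theorem sum_cellSq_le (hd : 1 ≤ d) (hP : M.IsSmoothRep u P) :
    ∑ T ∈ M.cells, cellSq T u ≤ (d + 1) * dgSq M u := by
  obtain ⟨h₁, h₂, h₃⟩ := dgSq_parts_nonneg M u
  have hd' : (1 : ℝ) ≤ d := by exact_mod_cast hd
  have h : ∑ T ∈ M.cells, cellSq T u
      ≤ (d + 1) * (∑ T ∈ M.cells, ∫ x in openCell T, frob (grad u x) (grad u x))
        + 2 * ∑ T ∈ M.cells, size T ^ 2 *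
        (∑ i, ∑ j, ∑ k ∈ Finset.Iic j, ∫ x in openCell T, second u i j k x ^ 2) := by
    rw [Finset.mul_sum, Finset.mul_sum, ← Finset.sum_add_distrib]
    refine Finset.sum_le_sum fun T hT => ?_
    have := mul_le_mul_of_nonneg_left (sum_second_le (hP T hT).1 (hP T hT).2)
      (sq_nonneg (size T))
    unfold cellSq
    linarith
  -- The factor 2 of the second derivatives is absorbed because $2\le d+1$.
  refine h.trans ?_
  unfold dgSq
  nlinarith

/-- Young's inequality for the consistency terms of `a_h`. -/
theorem abs_sum_avg_jumpT_le (hd : 2 ≤ d) {σ : ℝ} (hσ : M.ShapeRegular σ)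
    (hP : M.IsSmoothRep u P) (hR : M.IsSmoothRep w R) {θ : ℝ} (hθ : 0 < θ) :
    |∑ e ∈ M.sides, sideIntegral e (fun x => inner ℝ (avg M e (sgrad u) x) (jumpT M e w x))|
      ≤ θ * ((d + 1) ^ 2 * |σ| * dgSq M u) + θ⁻¹ * dgSq M w := by
  have h₁ : ∀ e ∈ M.sides,
      |sideIntegral e (fun x => inner ℝ (avg M e (sgrad u) x) (jumpT M e w x))|
        ≤ θ * (size e * sideIntegral e (fun x => ‖avg M e (sgrad u) x‖ ^ 2))
          + θ⁻¹ * ((size e)⁻¹ * sideIntegral e (fun x => ‖jumpT M e w x‖ ^ 2)) := by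
    intro e he
    -- This needs a side to have at least two vertices, that is $d\ge2$.
    have hs : 0 < size e := size_pos (by rw [(mem_sides.1 he).2]; omega)
    obtain ⟨A, hA, hAe, -⟩ := exists_continuous_avg he hP
    obtain ⟨J, hJ, hJe⟩ := exists_continuous_jumpT he hR
    rw [sideIntegral_congr (f := fun x => inner ℝ (avg M e (sgrad u) x) (jumpT M e w x))
        (g := fun x => inner ℝ (A x) (J x)) fun x hx => by
        simp only [hAe hx, hJe hx],
      sideIntegral_congr (f := fun x => ‖avg M e (sgrad u) x‖ ^ 2)
        (g := fun x => ‖A x‖ ^ 2) fun x hx => by simp only [hAe hx],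
      sideIntegral_congr (f := fun x => ‖jumpT M e w x‖ ^ 2) (g := fun x => ‖J x‖ ^ 2) fun x hx => by
        simp only [hJe hx]]
    have hi : ∀ f : E d → ℝ, Continuous f → Integrable f
        ((Measure.euclideanHausdorffMeasure (d - 1)).restrict (hull e)) := fun f hf =>
      integrableOn_side (by omega) he hf
    have h := abs_integral_le_young (f := fun x => inner ℝ (A x) (J x))
      (g := fun x => size e * ‖A x‖ ^ 2) (h := fun x => (size e)⁻¹ * ‖J x‖ ^ 2) (θ := θ)
      (hi _ (by fun_prop)) (hi _ (by fun_prop)) fun x => by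
        -- The weight $\theta h_e$ puts $h_e$ on the average and $h_e^{-1}$ on the jump, as in the
        -- DG norm.
        have := abs_inner_le_young (A x) (J x) (mul_pos hθ hs)
        rwa [mul_inv, mul_assoc, mul_assoc] at this
    rwa [integral_const_mul, integral_const_mul] at h
  refine (Finset.abs_sum_le_sum_abs _ _).trans ((Finset.sum_le_sum h₁).trans ?_)
  rw [Finset.sum_add_distrib, ← Finset.mul_sum, ← Finset.mul_sum]
  have h₂ := sum_size_mul_avg_le (by omega) hσ hP
  have h₃ := sum_cellSq_le (by omega) hP
  gcongr
  · refine h₂.trans ?_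
    calc (d + 1) * |σ| * ∑ T ∈ M.cells, cellSq T u
        ≤ (d + 1) * |σ| * ((d + 1) * dgSq M u) := by gcongr
      _ = _ := by ring
  · exact sum_jumpT_le_dgSq M w

theorem abs_sum_jumpT_jumpT_le (hd : 1 ≤ d) {η : ℝ} (hη : 0 ≤ η)
    (hP : M.IsSmoothRep u P) (hR : M.IsSmoothRep w R) {θ : ℝ} (hθ : 0 < θ) :
    |∑ e ∈ M.sides,
        sideIntegral e (fun x => η * (size e)⁻¹ * inner ℝ (jumpT M e u x) (jumpT M e w x))|
      ≤ θ * (η * dgSq M u) + θ⁻¹ * (η * dgSq M w) := by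
  have h₁ : ∀ e ∈ M.sides,
      |sideIntegral e (fun x => η * (size e)⁻¹ * inner ℝ (jumpT M e u x) (jumpT M e w x))|
        ≤ θ * (η * ((size e)⁻¹ * sideIntegral e (fun x => ‖jumpT M e u x‖ ^ 2)))
          + θ⁻¹ * (η * ((size e)⁻¹ * sideIntegral e (fun x => ‖jumpT M e w x‖ ^ 2))) := by
    intro e he
    have hs : 0 ≤ size e := size_nonneg e
    obtain ⟨A, hA, hAe⟩ := exists_continuous_jumpT he hP
    obtain ⟨J, hJ, hJe⟩ := exists_continuous_jumpT he hR
    rw [sideIntegral_congr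
        (f := fun x => η * (size e)⁻¹ * inner ℝ (jumpT M e u x) (jumpT M e w x))
        (g := fun x => η * (size e)⁻¹ * inner ℝ (A x) (J x)) fun x hx => by
        simp only [hAe hx, hJe hx],
      sideIntegral_congr (f := fun x => ‖jumpT M e u x‖ ^ 2) (g := fun x => ‖A x‖ ^ 2) fun x hx => by
        simp only [hAe hx],
      sideIntegral_congr (f := fun x => ‖jumpT M e w x‖ ^ 2) (g := fun x => ‖J x‖ ^ 2) fun x hx => by
        simp only [hJe hx]]
    have hi : ∀ f : E d → ℝ, Continuous f → Integrable f
        ((Measure.euclideanHausdorffMeasure (d - 1)).restrict (hull e)) := fun f hf =>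
      integrableOn_side hd he hf
    have h := abs_integral_le_young (f := fun x => η * (size e)⁻¹ * inner ℝ (A x) (J x))
      (g := fun x => η * ((size e)⁻¹ * ‖A x‖ ^ 2)) (h := fun x => η * ((size e)⁻¹ * ‖J x‖ ^ 2))
      (θ := θ) (hi _ (by fun_prop)) (hi _ (by fun_prop)) fun x => by
        rw [abs_mul, abs_of_nonneg (by positivity : 0 ≤ η * (size e)⁻¹)]
        have := mul_le_mul_of_nonneg_left (abs_inner_le_young (A x) (J x) hθ)
          (by positivity : 0 ≤ η * (size e)⁻¹)
        linarith
    simpa only [sideIntegral, integral_const_mul] using h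
  refine (Finset.abs_sum_le_sum_abs _ _).trans ((Finset.sum_le_sum h₁).trans ?_)
  simp only [Finset.sum_add_distrib, ← Finset.mul_sum]
  gcongr
  · exact sum_jumpT_le_dgSq M u
  · exact sum_jumpT_le_dgSq M w

theorem abs_sum_frob_sgrad_le (hP : M.IsSmoothRep u P) (hR : M.IsSmoothRep w R) {θ : ℝ}
    (hθ : 0 < θ) :
    |∑ T ∈ M.cells, ∫ x in openCell T, frob (sgrad u x) (sgrad w x)|
      ≤ θ * dgSq M u + θ⁻¹ * dgSq M w := by
  have hi : ∀ {v : E d → E d} {Q}, M.IsSmoothRep v Q → ∀ T ∈ M.cells,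
      IntegrableOn (fun x => frob (grad v x) (grad v x)) (openCell T) := fun hQ T hT =>
    integrableOn_openCell (continuous_frob (continuous_grad (hQ T hT).1)
      (continuous_grad (hQ T hT).1)) fun x hx => by simp only [grad_congr (hQ T hT).2 hx]
  have h₁ : ∀ T ∈ M.cells, |∫ x in openCell T, frob (sgrad u x) (sgrad w x)|
      ≤ θ * (∫ x in openCell T, frob (grad u x) (grad u x))
        + θ⁻¹ * ∫ x in openCell T, frob (grad w x) (grad w x) := by
    intro T hT
    refine abs_integral_le_young (hi hP T hT) (hi hR T hT) fun x => ?_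
    refine (abs_frob_le_young _ _ hθ).trans ?_
    have := frob_sgrad_le u x
    have := frob_sgrad_le w x
    gcongr
  refine (Finset.abs_sum_le_sum_abs _ _).trans ((Finset.sum_le_sum h₁).trans ?_)
  simp only [Finset.sum_add_distrib, ← Finset.mul_sum]
  gcongr
  · exact sum_frob_le_dgSq M u
  · exact sum_frob_le_dgSq M w

theorem abs_aForm_le (hd : 2 ≤ d) {σ : ℝ} (hσ : M.ShapeRegular σ) {η : ℝ} (hη : 0 ≤ η)
    (hP : M.IsSmoothRep u P) (hR : M.IsSmoothRep w R) {θ : ℝ} (hθ : 0 < θ) :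
    |aForm M η u w|
      ≤ (2 + η + (d + 1) ^ 2 * |σ|) * (θ * dgSq M u + θ⁻¹ * dgSq M w) := by
  have h₁ := abs_sum_frob_sgrad_le hP hR hθ
  have h₂ := abs_sum_avg_jumpT_le hd hσ hP hR hθ
  -- The roles of `u` and `w` are exchanged, so the weight $\theta^{-1}$ leaves $\theta$ with `u`.
  -- In the total, the 2 comes from the volume term and the jumps of one consistency term, $\eta$
  -- from the penalty, and $(d+1)^2|\sigma|$ from the averages.
  have h₃ := abs_sum_avg_jumpT_le hd hσ hR hP (inv_pos.2 hθ)
  have h₄ := abs_sum_jumpT_jumpT_le (by omega) hη hP hR hθ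
  rw [inv_inv] at h₃
  unfold aForm
  rw [abs_le] at *
  constructor <;> linarith [h₁.1, h₁.2, h₂.1, h₂.2, h₃.1, h₃.2, h₄.1, h₄.2]

end Side

/-! ### Finite element fields -/

section FiniteElement

variable {d : ℕ} {Ω : Set (E d)} {M : Triangulation d Ω}

theorem IsPoly.contDiff {k : ℕ} {f : E d → ℝ} (hf : IsPoly k f) : ContDiff ℝ ∞ f := by
  obtain ⟨P, -, hP⟩ := hf
  rw [funext hP]
  clear hP
  induction P using MvPolynomial.induction_on with
  | C a => simpa using contDiff_const
  | add p q hp hq => simpa using hp.add hq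
  | mul_X p i hp =>
    simpa using hp.mul (EuclideanSpace.proj i : E d →L[ℝ] ℝ).contDiff

theorem contDiff_of_mem_BDM {l : ℕ} {v : E d → E d} (hv : v ∈ BDM d l) : ContDiff ℝ ∞ v :=
  contDiff_euclidean.2 fun i => (hv i).contDiff

/-- Smoothness is all that the estimates take from the local displacement spaces, for either family
and any degree. -/
theorem contDiff_of_mem_space {fam : Family} {l : ℕ} {T : Finset (E d)} {v : E d → E d}
    (hv : v ∈ fam.space d l T) : ContDiff ℝ ∞ v := by
  cases fam with
  | bdm => exact contDiff_of_mem_BDM hv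
  | bdfm => exact contDiff_of_mem_BDM hv.1

theorem MemVec.exists_isSmoothRep {S : Finset (E d) → Set (E d → E d)} {u : E d → E d}
    (hu : MemVec M S u) (hS : ∀ T, ∀ v ∈ S T, ContDiff ℝ ∞ v) : ∃ P, M.IsSmoothRep u P := by
  classical
  choose! P hP using hu.2.1
  exact ⟨P, fun T hT => ⟨hS T _ (hP T hT).1, (hP T hT).2⟩⟩

/-- Finitely many closed cells cover $\Omega$ and their boundaries are null sets. Integrability of
`f` supplies measurability, and that of its square the $L^2$ bound. -/
theorem memLp_of_eqOn_openCell {f : E d → ℝ} {g : Finset (E d) → E d → ℝ}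
    (h : ∀ T ∈ M.cells, Continuous (g T) ∧ EqOn f (g T) (openCell T)) :
    MemLp f 2 (volume.restrict Ω) := by
  have key : ∀ (f : E d → ℝ) (g : Finset (E d) → E d → ℝ),
      (∀ T ∈ M.cells, Continuous (g T) ∧ EqOn f (g T) (openCell T)) → IntegrableOn f Ω := by
    intro f g h
    refine IntegrableOn.mono_set ?_ M.subset_iUnion_hull
    refine (integrableOn_finset_iUnion).2 fun T hT => ?_
    exact (integrableOn_openCell (h T hT).1 (h T hT).2).congr_set_ae (openCell_ae_eq_hull T).symm
  refine (memLp_two_iff_integrable_sq (key f g h).aestronglyMeasurable).2 ?_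
  exact key _ (fun T x => g T x ^ 2) fun T hT => ⟨(h T hT).1.pow 2, fun x hx => by
    simp only [(h T hT).2 hx]⟩

theorem memLp_div {u : E d → E d} {P : Finset (E d) → E d → E d} (hP : M.IsSmoothRep u P) :
    MemLp (div u) 2 (volume.restrict Ω) :=
  memLp_of_eqOn_openCell fun T hT => ⟨continuous_div (hP T hT).1, div_congr (hP T hT).2⟩

end FiniteElement

/-! ### Bounds for the integral forms -/

section Forms

variable {d : ℕ} {Ω : Set (E d)} {ι : Type*} [Fintype ι] {A : Matrix ι ι ℝ} {θ : ℝ}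

theorem integrable_inner_of_memLp {α V : Type*} [MeasurableSpace α] {μ : Measure α}
    [NormedAddCommGroup V] [InnerProductSpace ℝ V] {f g : α → V} (hf : MemLp f 2 μ)
    (hg : MemLp g 2 μ) : Integrable (fun x => inner ℝ (f x) (g x)) μ := by
  refine (L2.integrable_inner (𝕜 := ℝ) (hf.toLp f) (hg.toLp g)).congr ?_
  filter_upwards [hf.coeFn_toLp, hg.coeFn_toLp] with x h₁ h₂
  rw [h₁, h₂]

theorem integrableOn_vecForm (A : Matrix ι ι ℝ) {X Y : ι → E d → E d}
    (hX : ∀ a, MemLp (X a) 2 (volume.restrict Ω)) (hY : ∀ a, MemLp (Y a) 2 (volume.restrict Ω)) :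
    IntegrableOn (fun x => ∑ a, inner ℝ (∑ b, A a b • X b x) (Y a x)) Ω :=
  integrable_finsetSum _ fun a _ => integrable_inner_of_memLp
    (memLp_finsetSum _ fun b _ => (hX b).const_smul (A a b)) (hY a)

theorem integrableOn_scalForm (A : Matrix ι ι ℝ) {p q : ι → E d → ℝ}
    (hp : ∀ a, MemLp (p a) 2 (volume.restrict Ω)) (hq : ∀ a, MemLp (q a) 2 (volume.restrict Ω)) :
    IntegrableOn (fun x => (A *ᵥ fun j => p j x) ⬝ᵥ fun i => q i x) Ω :=
  integrable_finsetSum _ fun a _ =>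
    (memLp_finsetSum _ fun b _ => (hp b).const_mul (A a b)).integrable_mul (hq a)

theorem abs_vecForm_le (hA : A.PosSemidef) {X Y : ι → E d → E d}
    (hX : ∀ a, MemLp (X a) 2 (volume.restrict Ω)) (hY : ∀ a, MemLp (Y a) 2 (volume.restrict Ω))
    (hθ : 0 < θ) :
    |vecForm Ω A X Y| ≤ θ * vecForm Ω A X X + θ⁻¹ * vecForm Ω A Y Y :=
  abs_integral_le_young (integrableOn_vecForm A hX hX) (integrableOn_vecForm A hY hY) fun x =>
    abs_inner_sum_smul_le_young hA (fun a => X a x) (fun a => Y a x) hθ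

theorem abs_scalForm_le (hA : A.PosSemidef) {p q : ι → E d → ℝ}
    (hp : ∀ a, MemLp (p a) 2 (volume.restrict Ω)) (hq : ∀ a, MemLp (q a) 2 (volume.restrict Ω))
    (hθ : 0 < θ) :
    |scalForm Ω A p q| ≤ θ * scalForm Ω A p p + θ⁻¹ * scalForm Ω A q q :=
  abs_integral_le_young (integrableOn_scalForm A hp hp) (integrableOn_scalForm A hq hq) fun _ =>
    abs_mulVec_dotProduct_le_young hA _ _ hθ

theorem abs_integral_sum_mul_le [DecidableEq ι] (hA : A.PosDef) {p q : ι → E d → ℝ}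
    (hp : ∀ a, MemLp (p a) 2 (volume.restrict Ω)) (hq : ∀ a, MemLp (q a) 2 (volume.restrict Ω))
    (hθ : 0 < θ) :
    |∫ x in Ω, ∑ i, p i x * q i x| ≤ θ * scalForm Ω A p p + θ⁻¹ * scalForm Ω A⁻¹ q q :=
  abs_integral_le_young (integrableOn_scalForm A hp hp) (integrableOn_scalForm A⁻¹ hq hq) fun x =>
    abs_dotProduct_le_young_inv hA (fun i => p i x) (fun i => q i x) hθ

theorem vecForm_self_nonneg (hA : A.PosSemidef) (X : ι → E d → E d) : 0 ≤ vecForm Ω A X X :=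
  integral_nonneg fun x => inner_sum_smul_self_nonneg hA fun a => X a x

theorem scalForm_self_nonneg (hA : A.PosSemidef) (p : ι → E d → ℝ) : 0 ≤ scalForm Ω A p p :=
  integral_nonneg fun _ => mulVec_dotProduct_self_nonneg hA _

end Forms

/-! ### Boundedness -/

section Boundedness

variable {d n l : ℕ} {Ω : Set (E d)} {M : Triangulation d Ω} {fam : Family} {P : Params n}
  {X Y : Fields d n}

/-- `Real.sqrt` sends negative numbers to 0, so the radicand has to be shown nonnegative. -/
theorem normUV_sq (hP : P.Admissible) (M : Triangulation d Ω) (X : Fields d n) :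
    normUV M P X ^ 2 = P.mu * P.τ ^ 2 / 2 * dgSq M X.u
      + P.τ ^ 2 * P.lam / 4 * (∫ x in Ω, div X.u x ^ 2)
      + vecForm Ω P.Λuv X.stack X.stack
      + P.τ ^ 2 / 4 * scalForm Ω (P.Λ)⁻¹ (X.totalDiv P) (X.totalDiv P) := by
  have h₁ := dgSq_nonneg M X.u
  have h₂ : 0 ≤ ∫ x in Ω, div X.u x ^ 2 := integral_nonneg fun x => sq_nonneg _
  have h₃ := vecForm_self_nonneg (Ω := Ω) (Params.posSemidef_Λuv hP) X.stack
  have h₄ := scalForm_self_nonneg (Ω := Ω) (Params.posDef_Λ hP).inv.posSemidef (X.totalDiv P)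
  have := hP.mu_pos
  have := hP.lam_nonneg
  exact Real.sq_sqrt (by positivity)

theorem normP_sq (hP : P.Admissible) (Ω : Set (E d)) (X : Fields d n) :
    normP Ω P X ^ 2 = P.τ ^ 2 / 4 * scalForm Ω P.Λ X.p X.p := by
  have h := scalForm_self_nonneg (Ω := Ω) (Params.posDef_Λ hP).posSemidef X.p
  exact Real.sq_sqrt (by positivity)

theorem Fields.Mem.exists_isSmoothRep_u (hX : X.Mem M fam l) : ∃ Q, M.IsSmoothRep X.u Q :=
  hX.1.exists_isSmoothRep fun _ _ => contDiff_of_mem_space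

theorem Fields.Mem.memLp_stack (hX : X.Mem M fam l) :
    ∀ a, MemLp (X.stack a) 2 (volume.restrict Ω)
  | .inl (.inl _) => hX.1.1.1
  | .inl (.inr i) => (hX.2.1 i).1.1
  | .inr (.inl _) => hX.2.2.1.1.1
  | .inr (.inr i) => (hX.2.2.2.1 i).1.1

theorem Fields.Mem.memLp_p (hX : X.Mem M fam l) (i : Fin n) :
    MemLp (X.p i) 2 (volume.restrict Ω) :=
  (hX.2.2.2.2 i).1

theorem Fields.Mem.memLp_div_u (hX : X.Mem M fam l) : MemLp (div X.u) 2 (volume.restrict Ω) := by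
  obtain ⟨Q, hQ⟩ := hX.exists_isSmoothRep_u
  exact memLp_div hQ

theorem Fields.Mem.memLp_totalDiv (hX : X.Mem M fam l) (P : Params n) (i : Fin n) :
    MemLp (X.totalDiv P i) 2 (volume.restrict Ω) := by
  obtain ⟨Q, hQ⟩ := (hX.2.1 i).exists_isSmoothRep fun _ _ => contDiff_of_mem_space
  exact (memLp_div hQ).add (hX.memLp_div_u.const_mul (P.α i))

theorem abs_AForm_le_young (hd : 2 ≤ d) {σ : ℝ} (hσ : M.ShapeRegular σ) {η : ℝ} (hη : 0 ≤ η)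
    (hP : P.Admissible) (hX : X.Mem M fam l) (hY : Y.Mem M fam l) {θ : ℝ} (hθ : 0 < θ) :
    |AForm M η P X Y| ≤ (2 + η + (d + 1) ^ 2 * |σ|) *
      (θ * (normUV M P X ^ 2 + normP Ω P X ^ 2) + θ⁻¹ * (normUV M P Y ^ 2 + normP Ω P Y ^ 2)) := by
  obtain ⟨Q, hQ⟩ := hX.exists_isSmoothRep_u
  obtain ⟨R, hR⟩ := hY.exists_isSmoothRep_u
  have hΛ := Params.posDef_Λ hP
  set C := 2 + η + (d + 1) ^ 2 * |σ| with hC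
  have hC2 : 2 ≤ C := by
    have : 0 ≤ ((d : ℝ) + 1) ^ 2 * |σ| := by positivity
    linarith
  have hmu := hP.mu_pos
  have hlam := hP.lam_nonneg
  have h₁ := mul_le_mul_of_nonneg_left (abs_aForm_le hd hσ hη hQ hR hθ)
    (by positivity : 0 ≤ P.mu * P.τ ^ 2 / 2)
  have h₂ := mul_le_mul_of_nonneg_left (abs_integral_le_young (μ := volume.restrict Ω)
    (f := fun x => div X.u x * div Y.u x) hX.memLp_div_u.integrable_sq hY.memLp_div_u.integrable_sq
    fun x => abs_mul_le_young _ _ hθ) (by positivity : 0 ≤ P.τ ^ 2 * P.lam / 4)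
  have h₃ := abs_vecForm_le (Params.posSemidef_Λuv hP) hX.memLp_stack hY.memLp_stack hθ
  have h₄ := mul_le_mul_of_nonneg_left
    (abs_integral_sum_mul_le hΛ hX.memLp_p (hY.memLp_totalDiv P) hθ)
    (by positivity : 0 ≤ P.τ ^ 2 / 4)
  -- Here `Y` supplies the pressure and `X` the divergence; the inverted weight again gives $\theta$
  -- to `X`.
  have h₅ := mul_le_mul_of_nonneg_left
    (abs_integral_sum_mul_le hΛ hY.memLp_p (hX.memLp_totalDiv P) (inv_pos.2 hθ))
    (by positivity : 0 ≤ P.τ ^ 2 / 4)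
  have h₆ := mul_le_mul_of_nonneg_left
    (abs_scalForm_le (Params.posSemidef_Λ1 hP) hX.memLp_p hY.memLp_p hθ)
    (by positivity : 0 ≤ P.τ ^ 2 / 4)
  have hle : ∀ Z : Fields d n, Z.Mem M fam l → scalForm Ω P.Λ1 Z.p Z.p ≤ scalForm Ω P.Λ Z.p Z.p :=
    fun Z hZ => integral_mono (integrableOn_scalForm _ hZ.memLp_p hZ.memLp_p)
      (integrableOn_scalForm _ hZ.memLp_p hZ.memLp_p) fun x => Params.Λ1_mulVec_dotProduct_le hP _
  have hleX := hle X hX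
  have hleY := hle Y hY
  simp only [inv_inv, mul_comm (Y.p _ _)] at h₅
  have habs : ∀ a b c e f g : ℝ,
      |a + b + c - e - f - g| ≤ |a| + |b| + |c| + |e| + |f| + |g| := fun a b c e f g => by
    rw [abs_le]
    constructor <;> linarith [le_abs_self a, le_abs_self b, le_abs_self c, le_abs_self e,
      le_abs_self f, le_abs_self g, neg_abs_le a, neg_abs_le b, neg_abs_le c, neg_abs_le e,
      neg_abs_le f, neg_abs_le g]
  refine (habs _ _ _ _ _ _).trans ?_
  simp only [abs_mul (P.mu * P.τ ^ 2 / 2), abs_mul (P.τ ^ 2 * P.lam / 4), abs_mul (P.τ ^ 2 / 4),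
    abs_of_nonneg (by positivity : 0 ≤ P.mu * P.τ ^ 2 / 2),
    abs_of_nonneg (by positivity : 0 ≤ P.τ ^ 2 * P.lam / 4),
    abs_of_nonneg (by positivity : 0 ≤ P.τ ^ 2 / 4)]
  rw [normUV_sq hP, normUV_sq hP, normP_sq hP, normP_sq hP]
  have hdiv : ∀ Z : Fields d n, 0 ≤ ∫ x in Ω, div Z.u x ^ 2 := fun Z =>
    integral_nonneg fun x => sq_nonneg _
  have hvec : ∀ Z : Fields d n, 0 ≤ vecForm Ω P.Λuv Z.stack Z.stack := fun Z =>
    vecForm_self_nonneg (Params.posSemidef_Λuv hP) Z.stack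
  have htot : ∀ Z : Fields d n, 0 ≤ scalForm Ω (P.Λ)⁻¹ (Z.totalDiv P) (Z.totalDiv P) := fun Z =>
    scalForm_self_nonneg hΛ.inv.posSemidef _
  have hp : ∀ Z : Fields d n, 0 ≤ scalForm Ω P.Λ Z.p Z.p := fun Z =>
    scalForm_self_nonneg hΛ.posSemidef _
  -- The pressure is counted twice, in its pairing with the divergence and in the $\Lambda_1$ term;
  -- $C\ge2$ absorbs this.
  have hweak : ∀ {t a b v p : ℝ}, 0 < t → 0 ≤ a → 0 ≤ b → 0 ≤ v → 0 ≤ p →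
      t * (a + v + b + 2 * p) ≤ C * (t * (a + v + b + p)) := fun {t a b v p} ht ha hb hv hp => by
    have h := mul_le_mul_of_nonneg_right hC2 (by positivity : 0 ≤ t * (a + v + b + p))
    have : 0 ≤ t * (a + v + b) := by positivity
    linarith
  have hτlam : 0 ≤ P.τ ^ 2 * P.lam / 4 := by positivity
  have hτ : 0 ≤ P.τ ^ 2 / 4 := by positivity
  have hwX := hweak hθ (mul_nonneg hτlam (hdiv X)) (mul_nonneg hτ (htot X)) (hvec X)
    (mul_nonneg hτ (hp X))
  have hwY := hweak (inv_pos.2 hθ) (mul_nonneg hτlam (hdiv Y)) (mul_nonneg hτ (htot Y)) (hvec Y)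
    (mul_nonneg hτ (hp Y))
  have hΛ1 : P.τ ^ 2 / 4 * (θ * scalForm Ω P.Λ1 X.p X.p + θ⁻¹ * scalForm Ω P.Λ1 Y.p Y.p)
      ≤ P.τ ^ 2 / 4 * (θ * scalForm Ω P.Λ X.p X.p + θ⁻¹ * scalForm Ω P.Λ Y.p Y.p) := by
    gcongr
  linarith

end Boundedness

end MPET

theorem mainTheorem4 (d : ℕ) (hd : d = 2 ∨ d = 3) (η : ℝ) (hη : 0 < η) (σ : ℝ) :
    ∃ C : ℝ, 0 < C ∧
      ∀ (Ω : Set (MPET.E d)) (M : MPET.Triangulation d Ω), M.ShapeRegular σ →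
      ∀ (fam : MPET.Family) (l : ℕ), 1 ≤ l →
      ∀ (n : ℕ), 1 ≤ n →
      ∀ P : MPET.Params n, P.Admissible →
      ∀ X Y : MPET.Fields d n, X.Mem M fam l → Y.Mem M fam l →
        |MPET.AForm M η P X Y| ≤
          C * (MPET.normUV M P X + MPET.normP Ω P X) * (MPET.normUV M P Y + MPET.normP Ω P Y) := by
  -- The outer 2 is the cost of optimizing $\theta$; the rest is the constant for $a_h$.
  refine ⟨2 * (2 + η + (d + 1) ^ 2 * |σ|), by positivity, ?_⟩
  intro Ω M hσ fam l _ n _ P hP X Y hX hY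
  have hC : 0 < 2 + η + (d + 1) ^ 2 * |σ| := by positivity
  have hnn : ∀ Z : MPET.Fields d n, 0 ≤ MPET.normUV M P Z ∧ 0 ≤ MPET.normP Ω P Z := fun Z =>
    ⟨Real.sqrt_nonneg _, Real.sqrt_nonneg _⟩
  -- Passing to the square of the sum leaves one number for each argument, as the choice of $\theta$
  -- requires.
  have hsq : ∀ Z : MPET.Fields d n, MPET.normUV M P Z ^ 2 + MPET.normP Ω P Z ^ 2
      ≤ (MPET.normUV M P Z + MPET.normP Ω P Z) ^ 2 := fun Z => by
    nlinarith [mul_nonneg (hnn Z).1 (hnn Z).2]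
  have h := MPET.le_two_mul_of_forall_young 
    (x := |MPET.AForm M η P X Y| / (2 + η + (d + 1) ^ 2 * |σ|))
    (add_nonneg (hnn X).1 (hnn X).2) (add_nonneg (hnn Y).1 (hnn Y).2) fun θ hθ => by
      rw [div_le_iff₀' hC]
      refine (MPET.abs_AForm_le_young (by omega) hσ hη.le hP hX hY hθ).trans ?_
      have := hsq X
      have := hsq Y
      gcongr
  rw [div_le_iff₀' hC] at h
  linarith
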